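/- Let $\mathsf A$ be a finite alphabet, and let $S$ be the shift on $\mathsf A^{\mathbb Z}$, $S(x)(i)=x(i+1)$. A subshift is a closed $S$-invariant set $X\subseteq\mathsf A^{\mathbb Z}$; it is aperiodic if none of its elements is periodic. Two systems are conjugate if there is a homeomorphism between them that intertwines the two maps. For $x\in\mathsf A^{\mathbb Z}$ and $p\ge 1$ let $\mathrm{Per}_p(x)=\{i\in\mathbb Z: x(i+kp)=x(i)\ \text{for all } k\in\mathbb Z\}$, and let the $p$-skeleton $\mathrm{Skel}(x,p)$ be the sequence that equals $x(i)$ for $i\in\mathrm{Per}_p(x)$ and a blank symbol $\square\notin\mathsf A$ elsewhere. A Toeplitz sequence is an $x$ with $\bigcup_{p\ge1}\mathrm{Per}_p(x)=\mathbb Z$, and a Toeplitz subshift is the orbit closure $X=\overline{\{S^kx:k\in\mathbb Z\}}$ of a Toeplitz sequence $x$. A positive integer $p$ is an essential period of $x$ if $\mathrm{Skel}(x,p)$ has no positive period smaller than $p$; the scale of $X$ is the supernatural number that is the least common multiple of all essential periods of $x$ (it does not depend on the generating Toeplitz sequence $x$). The topological rank of a minimal Cantor system is the minimum of $\liminf_n|V_n|$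 over all simple properly ordered Bratteli diagrams $B=(V,E,\preceq)$ such that the system is conjugate to the path space $X_B$ with its Vershik map. For a Toeplitz subshift $X$ generated by an aperiodic Toeplitz sequence $x$ and for $p\ge1$, let $\mathrm{Parts}(X,p)$ be the partition of $X$ into the sets $\overline{\{S^ix: i\equiv k \pmod p\}}$, $0\le k<p$ (it does not depend on $x$). All elements of $W\in\mathrm{Parts}(X,p)$ have the same $p$-skeleton, denoted $\mathrm{Skel}(W,p)$. Let $\mathrm{Parts}_*(X,p)$ be the set of the $W\in\mathrm{Parts}(X,p)$ with $\mathrm{Skel}(W,p)(-1)=\square\neq\mathrm{Skel}(W,p)(0)$; for such $W$ let $\mathrm{length}(W)$ be the least $i\in\mathbb N$ with $\mathrm{Skel}(W,p)(i)=\square$. Let $\ell(X,p)$ be the maximum of $\mathrm{length}(W)$ over $W\in \mathrm{Parts}_*(X,p)$ and put $$\chi(X,p)=\bigl\{S^{\lfloor \ell(X,p)/2\rfloor}W : W\in\mathrm{Parts}_*(X,p),\ \mathrm{length}(W)=\ell(X,p)\bigr\}$$ (the empty family if $\mathrm{Parts}_*(X,p)=\varnothing$). For a permutation $\phi$ of $\mathsf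 A^p$ let $\widehat\phi\colon\mathsf A^{\mathbb Z}\to\mathsf A^{\mathbb Z}$ be given by $\widehat\phi(x)[kp,(k+1)p)=\phi(x[kp,(k+1)p))$ for all $k\in\mathbb Z$. For compact $K,L\subseteq\mathsf A^{\mathbb Z}$ write $K\,E_p\,L$ if $L=\widehat\phi(K)$ for some permutation $\phi$ of $\mathsf A^p$; for finite families $\mathcal K,\mathcal L$ of compact sets write $\mathcal K\,E_p^{\rm fin}\,\mathcal L$ if $\{[K]_{E_p}:K\in\mathcal K\}=\{[L]_{E_p}:L\in\mathcal L\}$. Theorem. Let $X,Y\subseteq\mathsf A^{\mathbb Z}$ be aperiodic Toeplitz subshifts of topological rank $2$. Suppose $(p_n)_{n\ge0}$ is an increasing sequence of positive integers such that $p_n\mid p_{n+1}$ for all $n$ and $\mathrm{lcm}(p_n)_{n\ge0}$ is the scale of both $X$ and $Y$. Then $(X,S)$ and $(Y,S)$ are conjugate if and only if there exists $N\in\mathbb N$ such that for all $n\ge N$, $$\chi(X,p_n)\;E_{p_n}^{\rm fin}\;\chi(Y,p_n).$$ -/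

import Mathlib

open SymbolicDynamics.FullShift (Subshift shift)

namespace ToeplitzRank

/-! ### Systems and conjugacy -/

/-- Two topological dynamical systems `(α, T)` and `(β, T')` are conjugate. -/
def Conjugate {α β : Type*} [TopologicalSpace α] [TopologicalSpace β]
    (T : α → α) (T' : β → β) : Prop :=
  ∃ e : α ≃ₜ β, ∀ a, e (T a) = T' (e a)

section Subshifts

variable {A : Type*} [TopologicalSpace A]

/-- The shift map `S` restricted to a subshift; here `shift k x i = x (k + i)`, so that `shift k`
is `S ^ k`. -/
def shiftOn (X : Subshift A ℤ) : X.carrier → X.carrier :=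
  (X.mapsTo 1).restrict (shift (1 : ℤ)) X.carrier X.carrier

/-- A bi-infinite word is periodic if it has a positive period. -/
def IsPeriodic {B : Type*} (x : ℤ → B) : Prop :=
  ∃ p : ℕ, 0 < p ∧ ∀ i : ℤ, x (i + p) = x i

/-- A subshift is aperiodic if all its elements are aperiodic. -/
def IsAperiodic (X : Subshift A ℤ) : Prop :=
  ∀ x ∈ X.carrier, ¬ IsPeriodic x

/-! ### Toeplitz subshifts -/

/-- The `p`-periodic part `Per_p(x)`. -/
def per {B : Type*} (p : ℕ) (x : ℤ → B) : Set ℤ :=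
  {i | ∀ k : ℤ, x (i + k * p) = x i}

/-- Toeplitz sequences. -/
def IsToeplitzSeq {B : Type*} (x : ℤ → B) : Prop :=
  ∀ i : ℤ, ∃ p : ℕ, 1 ≤ p ∧ i ∈ per p x

/-- `x` is a Toeplitz sequence and the closure of its orbit is `X`. -/
def ToeplitzGenerates (x : ℤ → A) (X : Subshift A ℤ) : Prop :=
  IsToeplitzSeq x ∧ X.carrier = closure (Set.range fun k : ℤ => shift k x)

/-- Toeplitz subshifts. -/
def IsToeplitz (X : Subshift A ℤ) : Prop :=
  ∃ x : ℤ → A, ToeplitzGenerates x X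

open Classical in
/-- The `p`-skeleton of `x`, where `none` is the blank symbol. -/
noncomputable def skel {B : Type*} (x : ℤ → B) (p : ℕ) : ℤ → Option B :=
  fun i => if i ∈ per p x then some (x i) else none

/-- `p` is an essential period of `x`: the `p`-skeleton of `x` has no smaller period. -/
def IsEssentialPeriod {B : Type*} (x : ℤ → B) (p : ℕ) : Prop :=
  0 < p ∧ ∀ q : ℕ, 0 < q → q < p → ¬ ∀ i : ℤ, skel x p (i + q) = skel x p i

/-- Supernatural numbers `∏ q ^ (u q)`, given by their exponents `u q ∈ ℕ ∪ {∞}`. -/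
abbrev Supernatural : Type := Nat.Primes → ℕ∞

/-- The least common multiple of a set of positive integers, as a supernatural number. -/
noncomputable def lcmOf (s : Set ℕ) : Supernatural :=
  fun q => ⨆ n ∈ s, ((n.factorization (q : ℕ) : ℕ) : ℕ∞)

/-- `u` is the scale of the Toeplitz subshift `X`: the least common multiple of all essential
periods of a Toeplitz sequence generating `X`. -/
def IsScale (X : Subshift A ℤ) (u : Supernatural) : Prop :=
  ∃ x : ℤ → A, ToeplitzGenerates x X ∧ u = lcmOf {p | IsEssentialPeriod x p}

/-- `A(x, p, k)`. -/
def residueOrbit (x : ℤ → A) (p : ℕ) (k : ℤ) : Set (ℤ → A) :=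
  {y | ∃ i : ℤ, i ≡ k [ZMOD p] ∧ y = shift i x}

/-- `Parts(X, p)`: the partition of `X` into the closures of the sets `A(x, p, k)`, where `x` is a
Toeplitz sequence generating `X` (the partition does not depend on `x`). -/
def parts (X : Subshift A ℤ) (p : ℕ) : Set (Set (ℤ → A)) :=
  {W | ∃ x : ℤ → A, ToeplitzGenerates x X ∧
    ∃ k : ℤ, 0 ≤ k ∧ k < p ∧ W = closure (residueOrbit x p k)}

open Classical in
/-- `Skel(W, p)`: the `p`-skeleton of any element of `W`; all elements of a member `W` of
`Parts(X, p)` have the same `p`-skeleton. -/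
noncomputable def partSkel (W : Set (ℤ → A)) (p : ℕ) : ℤ → Option A :=
  if h : W.Nonempty then skel h.some p else fun _ => none

/-- `Parts_*(X, p)`: a block of the skeleton begins at position `0`. -/
def partsStar (X : Subshift A ℤ) (p : ℕ) : Set (Set (ℤ → A)) :=
  {W | W ∈ parts X p ∧ partSkel W p (-1) = none ∧ partSkel W p 0 ≠ none}

/-- The length of the skeleton block at position `0`. -/
noncomputable def blockLength (W : Set (ℤ → A)) (p : ℕ) : ℕ :=
  sInf {i : ℕ | partSkel W p (i : ℤ) = none}

/-- `ℓ(X, p)`: the maximal length of a skeleton block. -/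
noncomputable def maxLength (X : Subshift A ℤ) (p : ℕ) : ℕ :=
  sSup ((fun W => blockLength W p) '' partsStar X p)

/-- `Parts_M(X, p)`: a longest block of the skeleton begins at position `0`. -/
def partsMax (X : Subshift A ℤ) (p : ℕ) : Set (Set (ℤ → A)) :=
  {W | W ∈ partsStar X p ∧ blockLength W p = maxLength X p}

/-- `χ(X, p)`: the members of `Parts_M(X, p)`, recentered. -/
def chi (X : Subshift A ℤ) (p : ℕ) : Set (Set (ℤ → A)) :=
  (fun W => shift ((maxLength X p / 2 : ℕ) : ℤ) '' W) '' partsMax X p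

end Subshifts

/-! ### Block permutations -/

section BlockPermutations

variable {A : Type*}

/-- The map `φ̂` on bi-infinite words that applies `φ` to each of the words `x[kp, (k+1)p)`
(and the identity in the meaningless case `p = 0`). -/
def blockMap (p : ℕ) (φ : Equiv.Perm (Fin p → A)) (x : ℤ → A) : ℤ → A := fun i =>
  if h : 0 < p then
    φ (fun j : Fin p => x (i / (p : ℤ) * p + (j : ℕ)))
      ⟨(i % (p : ℤ)).toNat, by
        have h1 := Int.emod_nonneg i (b := (p : ℤ)) (by omega)
        have h2 := Int.emod_lt_of_pos i (b := (p : ℤ)) (by omega)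
        omega⟩
  else x i

/-- The relation `E_p`. -/
def BlockEquiv (p : ℕ) (K L : Set (ℤ → A)) : Prop :=
  ∃ φ : Equiv.Perm (Fin p → A), L = blockMap p φ '' K

/-- The relation `E_p^fin`: the families `𝒦` and `ℒ` meet the same `E_p`-classes. -/
def BlockEquivFin (p : ℕ) (𝒦 ℒ : Set (Set (ℤ → A))) : Prop :=
  (fun K => {M | BlockEquiv p K M}) '' 𝒦 = (fun L => {M | BlockEquiv p L M}) '' ℒ

end BlockPermutations

/-! ### Bratteli–Vershik systems and topological rank -/

/-- Ordered Bratteli diagrams; `E n` is the set of edges from `V n` to `V (n + 1)`. -/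
structure OrderedBratteliDiagram where
  /-- vertices -/
  V : ℕ → Type
  /-- edges -/
  E : ℕ → Type
  /-- source -/
  s : ∀ {n : ℕ}, E n → V n
  /-- range -/
  r : ∀ {n : ℕ}, E n → V (n + 1)
  /-- the partial order on the edges -/
  order : ∀ n, PartialOrder (E n)
  finite_V : ∀ n, Finite (V n)
  finite_E : ∀ n, Finite (E n)
  card_V_zero : Nat.card (V 0) = 1
  s_surjective : ∀ n, Function.Surjective (s : E n → V n)
  r_surjective : ∀ n, Function.Surjective (r : E n → V (n + 1))
  comparable_iff : ∀ n (e f : E n), (e ≤ f ∨ f ≤ e) ↔ r e = r f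

namespace OrderedBratteliDiagram

variable (B : OrderedBratteliDiagram)

instance (n : ℕ) : PartialOrder (B.E n) := B.order n

/-- `B.Joined u m v`: some finite (possibly empty) path leads from the vertex `u` to the vertex
`v` of level `m`. -/
inductive Joined {n : ℕ} (u : B.V n) : (m : ℕ) → B.V m → Prop
  | refl : Joined u n u
  | step {m : ℕ} (e : B.E m) : Joined u m (B.s e) → Joined u (m + 1) (B.r e)

/-- `B` is simple: along some telescoping, any two vertices of consecutive levels are joined by
an edge, that is, by a finite path of `B`. -/
def IsSimple : Prop :=
  ∃ f : ℕ → ℕ, StrictMono f ∧ f 0 = 0 ∧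
    ∀ k (u : B.V (f k)) (v : B.V (f (k + 1))), B.Joined u (f (k + 1)) v

/-- The rank `liminf |V_n|` of `B`. -/
noncomputable def rank : ℕ∞ :=
  Filter.liminf (fun n => ((Nat.card (B.V n) : ℕ) : ℕ∞)) Filter.atTop

/-- The space `X_B` of infinite paths. -/
def PathSpace : Type :=
  {x : ∀ n, B.E n // ∀ n, B.r (x n) = B.s (x (n + 1))}

/-- The topology induced by the product of the discrete topologies on the sets of edges. -/
instance : TopologicalSpace B.PathSpace :=
  TopologicalSpace.induced (fun x => x.val)
    (@Pi.topologicalSpace ℕ B.E fun _ => ⊥)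

/-- `B` is properly ordered: there are a unique path of maximal edges and a unique path of
minimal edges. -/
def IsProperlyOrdered : Prop :=
  (∃! x : B.PathSpace, ∀ n, IsMax (x.val n)) ∧ (∃! x : B.PathSpace, ∀ n, IsMin (x.val n))

/-- `T` is the Vershik map of `B`: the maximal path goes to the minimal path, and in any other path
the first non-maximal edge is replaced by its successor, the edges before it by minimal edges, and
the later edges are kept. If `B` is properly ordered, exactly one map `T` has this property. -/
def IsVershikMap (T : B.PathSpace → B.PathSpace) : Prop :=
  (∀ x : B.PathSpace, (∀ n, IsMax (x.val n)) → ∀ n, IsMin ((T x).val n)) ∧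
  (∀ (x : B.PathSpace) (k : ℕ), (∀ i < k, IsMax (x.val i)) → ¬ IsMax (x.val k) →
    x.val k ⋖ (T x).val k ∧ (∀ i < k, IsMin ((T x).val i)) ∧
      ∀ i, k < i → (T x).val i = x.val i)

end OrderedBratteliDiagram

/-- `B` is a Bratteli–Vershik representation of the system `(α, T)`. -/
def IsBVRepresentation {α : Type*} [TopologicalSpace α] (B : OrderedBratteliDiagram)
    (T : α → α) : Prop :=
  B.IsSimple ∧ B.IsProperlyOrdered ∧
    ∃ L : B.PathSpace → B.PathSpace, B.IsVershikMap L ∧ Conjugate T L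

/-- The system `(α, T)` has topological rank `K`: this is the minimal rank of its Bratteli–Vershik
representations. -/
def HasTopologicalRank {α : Type*} [TopologicalSpace α] (T : α → α) (K : ℕ) : Prop :=
  IsLeast {k : ℕ | ∃ B : OrderedBratteliDiagram, IsBVRepresentation B T ∧ B.rank = (k : ℕ∞)} K

end ToeplitzRank

open ToeplitzRank

/-! From a conjugacy `f` to equivalent families: a representation of rank two has arbitrarily deep
levels with at most two vertices. Such a level cuts `X` into at most two towers, and if it is deep
enough, the code `κ z` (the tower floor containing `z`) determines both `z 0` and `f z 0`
(`exists_towerCoding`). By aperiodicity the words `u`, `v` read along the towers do not commute.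
Hence every concatenation of them starts with the longest common prefix of `uv` and `vu`, and the
next letter reveals its first word (`exists_stream_prefix`). Ambiguity of `κ` on a set can begin
only at a tower boundary, so it becomes visible in the letters after a delay that is constant on
each side: maximal intervals of constant letters are maximal intervals of constant code, lengthened
by fixed amounts (`exists_run_extension`). This applies to the letters of `z` and of `f z` with the
same `κ`, and the constants do not depend on `p`. Skeleton blocks are intervals of constant letters,
so for large `p_n` the longest blocks of `X` and `Y` correspond and their centres are displaced
boundedly. Around such a centre the skeleton is filled well beyond the coding radii of `f` and its
inverse; cutting there, `f` followed by a bounded shift acts as a bijection on the occurring words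
of length `p_n` (`blockEquiv_image`, `exists_chi_blockEquiv`). Conversely, `χ(X, p_n)` is nonempty
for large `n`, so some part of `X` is block equivalent to a part of `Y`. A block map commutes with
`S ^ p_n`, and a part determines shifts modulo `p_n` because `p_n` divides the scale
(`dvd_of_shift_mem`). So `S ^ k w ↦ S ^ k (φ̂ w)` is well defined and is a conjugacy
(`conjugate_of_blockEquiv`). -/

namespace ToeplitzRank

/-! ### Streams of two words -/

section Streams

variable {A : Type*}

/-- The list `l` is a prefix of the infinite word `w`. -/
def HasPrefix (l : List A) (w : ℕ → A) : Prop :=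
  ∀ j (h : j < l.length), l[j] = w j

lemma HasPrefix.of_isPrefix {l m : List A} {w : ℕ → A} (h : HasPrefix m w) (hl : l <+: m) :
    HasPrefix l w := by
  intro j hj
  rw [← h j (hj.trans_le hl.length_le)]
  exact hl.getElem hj

lemma HasPrefix.append {l m : List A} {w : ℕ → A} (hl : HasPrefix l w)
    (hm : HasPrefix m fun j => w (j + l.length)) : HasPrefix (l ++ m) w := by
  intro j hj
  rw [List.getElem_append]
  split_ifs with h
  · exact hl j h
  · have hj' : j - l.length < m.length := by
      rw [List.length_append] at hj
      omega
    rw [hm _ hj']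
    exact congrArg w (Nat.sub_add_cancel (not_lt.1 h))

/-- The concatenation of the words `W (s 0), …, W (s (k - 1))`. -/
def concatWords (W : Bool → List A) (s : ℕ → Bool) : ℕ → List A
  | 0 => []
  | k + 1 => concatWords W s k ++ W (s k)

/-- `w` is the infinite concatenation of the words `W (s 0), W (s 1), …`. -/
def IsStream (W : Bool → List A) (s : ℕ → Bool) (w : ℕ → A) : Prop :=
  ∀ k, HasPrefix (concatWords W s k) w

lemma le_length_concatWords {W : Bool → List A} (hW : ∀ b, W b ≠ []) (s : ℕ → Bool) (k : ℕ) :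
    k ≤ (concatWords W s k).length := by
  induction k with
  | zero => simp
  | succ k ih =>
    have := List.length_pos_iff.2 (hW (s k))
    simp only [concatWords, List.length_append]
    omega

lemma exists_common_prefix : ∀ (l m : List A), l.length = m.length → l ≠ m →
    ∃ (z : List A) (a b : A), a ≠ b ∧ z ++ [a] <+: l ∧ z ++ [b] <+: m
  | [], [], _, h => absurd rfl h
  | [], _ :: _, h, _ => by simp at h
  | _ :: _, [], h, _ => by simp at h
  | a :: l, b :: m, h, hne => by
    by_cases hab : a = b
    · subst hab
      obtain ⟨z, c, d, hcd, h1, h2⟩ := exists_common_prefix l m (by simpa using h)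
        (fun e => hne (by rw [e]))
      exact ⟨a :: z, c, d, hcd, by simpa using h1, by simpa using h2⟩
    · exact ⟨[], a, b, hab, by simp, by simp⟩

/-- A tail `z` that reproduces itself behind each word may be pushed past any number of words, so
the beginning is governed by the first word and `z` alone. -/
lemma prefix_concatWords_append {W : Bool → List A} {z : List A}
    (hz : ∀ b, z <+: W b ++ z) (s : ℕ → Bool) (k : ℕ) :
    W (s 0) ++ z <+: concatWords W s (k + 1) ++ z := by
  induction k with
  | zero => simp [concatWords]
  | succ k ih =>
    refine ih.trans ?_
    rw [concatWords.eq_2 W s (k + 1), List.append_assoc, List.prefix_append_right_inj]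
    exact hz _

/-- All streams of two words `u`, `v` with `uv ≠ vu` have a common prefix of the same length,
and the letter after it determines the first word. -/
theorem exists_stream_prefix {W : Bool → List A} (hW : ∀ b, W b ≠ [])
    (hne : W true ++ W false ≠ W false ++ W true) :
    ∃ (d : ℕ) (z : ℕ → A) (c : Bool → A), c true ≠ c false ∧
      ∀ s w, IsStream W s w → (∀ j < d, w j = z j) ∧ w d = c (s 0) := by
  obtain ⟨z, a, b, hab, h1, h2⟩ := exists_common_prefix _ _ (by simp [add_comm]) hne
  have hp1 : z <+: W true ++ W false := (List.prefix_append z [a]).trans h1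
  have hp2 : z <+: W false ++ W true := (List.prefix_append z [b]).trans h2
  have hz3 : ∀ e, W e ++ z <+: W e ++ (W (!e) ++ W e) := by
    intro e
    rw [List.prefix_append_right_inj]
    cases e
    · exact hp1
    · exact hp2
  -- Both sides are prefixes of `W e ++ W (!e) ++ W e`. As `W e` is nonempty, the left one is not
  -- longer, hence is a prefix of the right one.
  have hzc : ∀ e, z ++ [if e then a else b] <+: W e ++ z := by
    intro e
    have h3 : z ++ [if e then a else b] <+: W e ++ (W (!e) ++ W e) := by
      rw [← List.append_assoc]
      refine List.IsPrefix.trans ?_ (List.prefix_append _ _)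
      cases e
      · exact h2
      · exact h1
    refine List.prefix_of_prefix_length_le h3 (hz3 e) ?_
    have := List.length_pos_iff.2 (hW e)
    simp only [List.length_append, List.length_cons, List.length_nil]
    omega
  have hz : ∀ e, z <+: W e ++ z := fun e => (List.prefix_append z _).trans (hzc e)
  refine ⟨z.length, fun j => z.getD j a, fun e => if e then a else b, by simpa using hab, ?_⟩
  intro s w hw
  have hpre : HasPrefix (z ++ [if s 0 then a else b]) w := by
    -- Each word has at least one letter, so this many words cover `z` and the letter after it.
    refine HasPrefix.of_isPrefix (hw ((z.length + 1) + 1)) ?_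
    refine List.prefix_of_prefix_length_le
      ((hzc _).trans (prefix_concatWords_append hz s (z.length + 1)))
      (List.prefix_append _ _) ?_
    have := le_length_concatWords hW s (z.length + 1 + 1)
    simp only [List.length_append, List.length_cons, List.length_nil]
    omega
  constructor
  · intro j hj
    rw [← hpre j (by simp; omega), List.getElem_append_left hj]
    simp [hj]
  · rw [← hpre z.length (by simp)]
    simp

lemma append_comm_concatWords {W : Bool → List A} (l : List A)
    (hl : ∀ b, l ++ W b = W b ++ l) (s : ℕ → Bool) (k : ℕ) :
    l ++ concatWords W s k = concatWords W s k ++ l := by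
  induction k with
  | zero => simp [concatWords]
  | succ k ih =>
    rw [concatWords, ← List.append_assoc, ih, List.append_assoc, hl, List.append_assoc]

/-- Streams of two commuting words coincide. -/
theorem stream_eq_of_comm {W : Bool → List A} (hW : ∀ b, W b ≠ [])
    (hc : W true ++ W false = W false ++ W true) {s s' : ℕ → Bool} {w w' : ℕ → A}
    (hw : IsStream W s w) (hw' : IsStream W s' w') : w = w' := by
  funext j
  have hWW : ∀ b b', W b ++ W b' = W b' ++ W b := by
    rintro (_ | _) (_ | _) <;> simp [hc]
  -- The two finite concatenations `P`, `P'` commute, so both are prefixes of `P ++ P' = P' ++ P`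
  -- and agree at the index `j`, which lies in both.
  have h1 : ∀ b, concatWords W s (j + 1) ++ W b = W b ++ concatWords W s (j + 1) := fun b =>
    (append_comm_concatWords _ (fun b' => hWW b b') s _).symm
  have h2 := append_comm_concatWords _ h1 s' (j + 1)
  have l1 := le_length_concatWords hW s (j + 1)
  have l2 := le_length_concatWords hW s' (j + 1)
  rw [← hw (j + 1) j (by omega), ← hw' (j + 1) j (by omega)]
  rw [← List.getElem_append_left (as := concatWords W s (j + 1)) (bs := concatWords W s' (j + 1))]
  rw [← List.getElem_append_left (as := concatWords W s' (j + 1)) (bs := concatWords W s (j + 1))]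
  · simp only [h2]
  · simp; omega
  · simp; omega

/-- A reading map along a deterministic step reads a stream. -/
lemma isStream_of_step {σ : Type*} {W : Bool → List A} (step : σ → σ) (b : σ → Bool)
    (read : σ → ℕ → A) (hpre : ∀ x, HasPrefix (W (b x)) (read x))
    (hstep : ∀ x j, read (step x) j = read x (j + (W (b x)).length)) (x : σ) :
    IsStream W (fun k => b (step^[k] x)) (read x) := by
  have key : ∀ k, HasPrefix (concatWords W (fun k => b (step^[k] x)) k) (read x) ∧
      ∀ j, read (step^[k] x) j =
        read x (j + (concatWords W (fun k => b (step^[k] x)) k).length) := by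
    intro k
    induction k with
    | zero => exact ⟨fun j hj => by simp [concatWords] at hj, fun j => rfl⟩
    | succ k ih =>
      refine ⟨ih.1.append ?_, ?_⟩
      · have := hpre (step^[k] x)
        intro j hj
        exact (this j hj).trans (ih.2 j)
      · intro j
        rw [Function.iterate_succ_apply', hstep, ih.2]
        simp only [concatWords, List.length_append]
        congr 1
        omega
  exact fun k => (key k).1

end Streams

/-! ### Runs of constancy -/

/-- `[a, b)` is a maximal interval contained in `C`. -/
def IsRun (C : Set ℤ) (a b : ℤ) : Prop :=
  a < b ∧ (∀ i, a ≤ i → i < b → i ∈ C) ∧ a - 1 ∉ C ∧ b ∉ C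

lemma exists_isRun {C : Set ℤ} {a b i : ℤ} (hi : i ∈ C) (ha : a ∉ C) (hai : a ≤ i) (hb : b ∉ C)
    (hib : i ≤ b) : ∃ e g, IsRun C e g ∧ e ≤ i ∧ i < g := by
  obtain ⟨g, ⟨hg, hgi⟩, hgmin⟩ := Int.exists_least_of_bdd (P := fun k => k ∉ C ∧ i ≤ k)
    ⟨i, fun _ h => h.2⟩ ⟨b, hb, hib⟩
  obtain ⟨e, ⟨he, hei⟩, hemax⟩ := Int.exists_greatest_of_bdd (P := fun k => k ∉ C ∧ k ≤ i)
    ⟨i, fun _ h => h.2⟩ ⟨a, ha, hai⟩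
  have h1 : g ≠ i := fun h => hg (h ▸ hi)
  have h2 : e ≠ i := fun h => he (h ▸ hi)
  refine ⟨e + 1, g, ⟨by omega, fun k h3 h4 => ?_, by simpa using he, hg⟩, by omega, by omega⟩
  by_contra hk
  rcases le_total i k with h | h
  · have := hgmin k ⟨hk, h⟩
    omega
  · have := hemax k ⟨hk, h⟩
    omega

lemma IsRun.unique {C : Set ℤ} {a b a' b' i : ℤ} (h : IsRun C a b) (h' : IsRun C a' b')
    (h1 : a ≤ i) (h2 : i < b) (h1' : a' ≤ i) (h2' : i < b') : a = a' ∧ b = b' := by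
  obtain ⟨_, hC, ha, hb⟩ := h
  obtain ⟨_, hC', ha', hb'⟩ := h'
  refine ⟨?_, ?_⟩
  · rcases lt_trichotomy a a' with h | h | h
    · exact absurd (hC (a' - 1) (by omega) (by omega)) ha'
    · exact h
    · exact absurd (hC' (a - 1) (by omega) (by omega)) ha
  · rcases lt_trichotomy b b' with h | h | h
    · exact absurd (hC' b (by omega) (by omega)) hb
    · exact h
    · exact absurd (hC b' (by omega) (by omega)) hb'

/-- The set of the `i` for which `φ i` is constant on `W`. -/
def constSet {Z B : Type*} (φ : ℤ → Z → B) (W : Set Z) : Set ℤ :=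
  {i | ∀ y ∈ W, ∀ y' ∈ W, φ i y = φ i y'}

lemma exists_ne_of_notMem_constSet {Z B : Type*} {φ : ℤ → Z → B} {W : Set Z} {i : ℤ}
    (h : i ∉ constSet φ W) : ∃ y ∈ W, ∃ y' ∈ W, φ i y ≠ φ i y' := by
  simpa [constSet] using h

/-! ### Tower codings -/

/-- A coding `κ` of a `ℤ`-action by the levels of at most two towers, with bottom levels `F`. -/
structure TowerCoding {Z Q : Type*} (τ : ℤ → Z → Z) (κ : Z → Q) (F : Set Q) : Prop where
  zero : ∀ z, τ 0 z = z
  add : ∀ a b z, τ (a + b) z = τ b (τ a z)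
  next : ∀ z z', κ z = κ z' → κ (τ 1 z) ∉ F → κ (τ 1 z) = κ (τ 1 z')
  prev : ∀ z z', κ z = κ z' → κ z ∉ F → κ (τ (-1) z) = κ (τ (-1) z')
  two : ∃ a b, ∀ z, κ z ∈ F → κ z = a ∨ κ z = b

/-- A symbolic presentation `ψ`, without long periodic words, of a `ℤ`-action such that `κ` and
`ψ` determine each other locally. -/
structure SymbolicPresentation {Z Q A : Type*} (τ : ℤ → Z → Z) (κ : Z → Q) (ψ : Z → ℤ → A) :
    Prop where
  equivariant : ∀ k z i, ψ (τ k z) i = ψ z (k + i)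
  letter : ∀ z z', κ z = κ z' → ψ z 0 = ψ z' 0
  recognizable : ∃ ρ : ℕ, ∀ z z', (∀ i : ℤ, -ρ ≤ i → i ≤ ρ → ψ z i = ψ z' i) → κ z = κ z'
  aperiodic : ∀ t : ℕ, 0 < t → ∃ M : ℕ, ∀ z, ∃ i : ℕ, i < M ∧ ψ z (i + t) ≠ ψ z i

variable {Z Q A : Type*} {τ : ℤ → Z → Z} {κ : Z → Q} {F : Set Q} {ψ : Z → ℤ → A}

lemma SymbolicPresentation.letter_at (hψ : SymbolicPresentation τ κ ψ) {z z' : Z} {i i' : ℤ}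
    (h : κ (τ i z) = κ (τ i' z')) : ψ z i = ψ z' i' := by
  simpa [hψ.equivariant] using hψ.letter _ _ h

namespace TowerCoding

lemma next_mem (hκ : TowerCoding τ κ F) {z z' : Z} (h : κ z = κ z') (hz : κ (τ 1 z) ∈ F) :
    κ (τ 1 z') ∈ F := by
  by_contra hz'
  exact hz' (hκ.next z' z h.symm hz' ▸ hz)

/-- Off `F` the code evolves deterministically. An orbit avoiding `F` would repeat a code, hence
have eventually periodic codes and letters, against aperiodicity. -/
lemma exists_pos_mem [Finite Q] (hκ : TowerCoding τ κ F) (hψ : SymbolicPresentation τ κ ψ)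
    (z : Z) : ∃ i : ℕ, 0 < i ∧ κ (τ i z) ∈ F := by
  by_contra! hno
  obtain ⟨i, j, hij, he⟩ : ∃ i j : ℕ, i < j ∧ κ (τ i z) = κ (τ j z) := by
    obtain ⟨i, j, hne, he⟩ := Finite.exists_ne_map_eq_of_infinite fun i : ℕ => κ (τ i z)
    rcases lt_or_gt_of_ne hne with h | h
    · exact ⟨i, j, h, he⟩
    · exact ⟨j, i, h, he.symm⟩
  have key : ∀ m : ℕ, κ (τ ((i + m : ℕ) : ℤ) z) = κ (τ ((j + m : ℕ) : ℤ) z) := by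
    intro m
    induction m with
    | zero => exact he
    | succ m ih =>
      have h1 : ∀ n : ℕ, τ ((n + (m + 1) : ℕ) : ℤ) z = τ 1 (τ ((n + m : ℕ) : ℤ) z) := by
        intro n
        rw [← hκ.add]
        push_cast
        rw [add_assoc]
      rw [h1, h1]
      refine hκ.next _ _ ih ?_
      rw [← h1]
      exact hno _ (by omega)
  obtain ⟨M, hM⟩ := hψ.aperiodic (j - i) (by omega)
  obtain ⟨m, -, hm⟩ := hM (τ i z)
  apply hm
  rw [hψ.equivariant, hψ.equivariant]
  have := hψ.letter_at (key m)
  push_cast at this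
  rw [this, Nat.cast_sub hij.le]
  congr 1
  ring

lemma exists_neg_mem [Finite Q] (hκ : TowerCoding τ κ F) (hψ : SymbolicPresentation τ κ ψ)
    (z : Z) : ∃ i : ℕ, 0 < i ∧ κ (τ (-i) z) ∈ F := by
  by_contra! hno
  obtain ⟨i, j, hi, hij, he⟩ : ∃ i j : ℕ, 0 < i ∧ i < j ∧ κ (τ (-i) z) = κ (τ (-j) z) := by
    -- The indices start at `1`: `prev` needs the current point outside `F`, which is known only at
    -- nonzero distance.
    obtain ⟨i, j, hne, he⟩ := Finite.exists_ne_map_eq_of_infinite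
      fun i : ℕ => κ (τ (-((i + 1 : ℕ) : ℤ)) z)
    rcases lt_or_gt_of_ne hne with h | h
    · exact ⟨i + 1, j + 1, by omega, by omega, he⟩
    · exact ⟨j + 1, i + 1, by omega, by omega, he.symm⟩
  have key : ∀ m : ℕ, κ (τ (-((i + m : ℕ) : ℤ)) z) = κ (τ (-((j + m : ℕ) : ℤ)) z) := by
    intro m
    induction m with
    | zero => exact he
    | succ m ih =>
      have h1 : ∀ n : ℕ, τ (-((n + (m + 1) : ℕ) : ℤ)) z = τ (-1) (τ (-((n + m : ℕ) : ℤ)) z) := by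
        intro n
        rw [← hκ.add]
        congr 1
        push_cast
        ring
      rw [h1, h1]
      exact hκ.prev _ _ ih (hno _ (by omega))
  obtain ⟨M, hM⟩ := hψ.aperiodic (j - i) (by omega)
  -- Periodicity is known only to the left of the repetition, so the window of length `M` is placed
  -- entirely there.
  obtain ⟨m, hmM, hm⟩ := hM (τ (-((j + M : ℕ) : ℤ)) z)
  apply hm
  rw [hψ.equivariant, hψ.equivariant]
  have := hψ.letter_at (key (M - m))
  rw [Nat.cast_sub hij.le]
  convert this using 2 <;> push_cast [hmM.le] <;> ring

/-- The data of the two towers: points `t b` in the bases and heights `h b`. -/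
lemma exists_towers [Finite Q] [Nonempty Z] (hκ : TowerCoding τ κ F)
    (hψ : SymbolicPresentation τ κ ψ) :
    ∃ (t : Bool → Z) (h : Bool → ℕ), (∀ b, κ (t b) ∈ F) ∧
      (∀ z, κ z ∈ F → ∃ b, κ z = κ (t b)) ∧ (∀ b, 0 < h b) ∧
      ∀ b z, κ z = κ (t b) → (∀ j : ℕ, j < h b → κ (τ j z) = κ (τ j (t b))) ∧
        κ (τ (h b) z) ∈ F ∧ ∀ j : ℕ, 0 < j → j < h b → κ (τ j z) ∉ F := by
  classical
  obtain ⟨t, ht, hcov⟩ : ∃ t : Bool → Z, (∀ b, κ (t b) ∈ F) ∧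
      (∀ z, κ z ∈ F → ∃ b, κ z = κ (t b)) := by
    obtain ⟨a, b, hab⟩ := hκ.two
    obtain ⟨z⟩ := ‹Nonempty Z›
    obtain ⟨i, -, hi⟩ := hκ.exists_pos_mem hψ z
    -- A candidate code that is not attained in `F` is replaced by that of an arbitrary point of
    -- `F`; the two towers may thus coincide.
    have hex : ∀ c, ∃ x, κ x ∈ F ∧ ((∃ y, κ y ∈ F ∧ κ y = c) → κ x = c) := by
      intro c
      by_cases h : ∃ y, κ y ∈ F ∧ κ y = c
      · obtain ⟨y, hy, hc⟩ := h
        exact ⟨y, hy, fun _ => hc⟩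
      · exact ⟨_, hi, fun h' => absurd h' h⟩
    obtain ⟨x, hx, hxa⟩ := hex a
    obtain ⟨y, hy, hyb⟩ := hex b
    refine ⟨fun b => if b then x else y, by rintro (_ | _) <;> simpa, fun z hz => ?_⟩
    rcases hab z hz with h | h
    · exact ⟨true, by simp [h, hxa ⟨z, hz, h⟩]⟩
    · exact ⟨false, by simp [h, hyb ⟨z, hz, h⟩]⟩
  have hret := fun b => hκ.exists_pos_mem hψ (t b)
  refine ⟨t, fun b => Nat.find (hret b), ht, hcov, fun b => (Nat.find_spec (hret b)).1, ?_⟩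
  intro b z hz
  have hsucc : ∀ (j : ℕ) x, τ ((j + 1 : ℕ) : ℤ) x = τ 1 (τ j x) := fun j x => by
    rw [← hκ.add]; push_cast; rfl
  have hmin : ∀ j : ℕ, 0 < j → j < Nat.find (hret b) → κ (τ j (t b)) ∉ F :=
    fun j h1 h2 h3 => Nat.find_min (hret b) h2 ⟨h1, h3⟩
  have key : ∀ j : ℕ, j < Nat.find (hret b) → κ (τ j z) = κ (τ j (t b)) := by
    intro j
    induction j with
    | zero => intro _; simpa [hκ.zero] using hz
    | succ j ih =>
      intro hj
      rw [hsucc, hsucc]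
      refine (hκ.next _ _ (ih (by omega)).symm ?_).symm
      rw [← hsucc]
      exact hmin _ (by omega) hj
  refine ⟨key, ?_, fun j h1 h2 => key j h2 ▸ hmin j h1 h2⟩
  obtain ⟨hpos, hF⟩ := Nat.find_spec (hret b)
  obtain ⟨m, hm⟩ : ∃ m, Nat.find (hret b) = m + 1 := ⟨Nat.find (hret b) - 1, by omega⟩
  beta_reduce
  rw [hm, hsucc] at hF ⊢
  exact hκ.next_mem (key m (by omega)).symm hF

/-- The right and left ends of the words read along the two towers: all words that follow a tower
start in the same way and the first difference determines the tower; and likewise to the left. -/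
lemma exists_divergence [Finite Q] [Nonempty Z] (hκ : TowerCoding τ κ F)
    (hψ : SymbolicPresentation τ κ ψ) :
    ∃ (t : Bool → Z) (h : Bool → ℕ), (∀ b, 0 < h b) ∧
      (∀ z, κ z ∈ F → ∃ b, κ z = κ (t b)) ∧
      (∀ z, κ z ∈ F → ∃ b, κ (τ (-h b) z) = κ (t b)) ∧
      (∀ b z, κ z = κ (t b) → κ (τ (h b - 1) z) = κ (τ (h b - 1) (t b))) ∧
      (∃ (d : ℕ) (u : ℕ → A) (c : Bool → A), c true ≠ c false ∧ ∀ z b, κ z = κ (t b) →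
        (∀ j < d, ψ z j = u j) ∧ ψ z d = c b) ∧
      (∃ (d : ℕ) (u : ℕ → A) (c : Bool → A), c true ≠ c false ∧ ∀ z b, κ z = κ (t b) →
        (∀ j < d, ψ z (h b - 1 - j) = u j) ∧ ψ z (h b - 1 - d) = c b) := by
  obtain ⟨t, h, ht, hcov, hpos, htow⟩ := hκ.exists_towers hψ
  -- The previous visit to `F` lies in the base of some tower `b`, and the first return from there
  -- takes exactly `h b` steps.
  have hback : ∀ z, κ z ∈ F → ∃ b, κ (τ (-h b) z) = κ (t b) := by
    classical
    intro z hz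
    have hex := hκ.exists_neg_mem hψ z
    obtain ⟨h1, h2⟩ := Nat.find_spec hex
    have h3 : ∀ j, 0 < j → j < Nat.find hex → κ (τ (-j) z) ∉ F :=
      fun j h4 h5 h6 => Nat.find_min hex h5 ⟨h4, h6⟩
    generalize Nat.find hex = i at h1 h2 h3
    obtain ⟨b, hb⟩ := hcov _ h2
    have hle : h b ≤ i := by
      by_contra hlt
      refine (htow b _ hb).2.2 i h1 (by omega) ?_
      rw [← hκ.add, neg_add_cancel, hκ.zero]
      exact hz
    have hge : i ≤ h b := by
      by_contra hlt
      have hp := hpos b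
      refine h3 (i - h b) (by omega) (by omega) ?_
      have := (htow b _ hb).2.1
      rw [← hκ.add] at this
      convert this using 3
      push_cast [hle]
      ring
    obtain rfl : i = h b := le_antisymm hge hle
    exact ⟨b, hb⟩
  let W : Bool → List A := fun b => List.ofFn fun j : Fin (h b) => ψ (t b) (j : ℕ)
  have hWlen : ∀ b, (W b).length = h b := fun b => by simp [W]
  have hW : ∀ b, W b ≠ [] := fun b => List.length_pos_iff.1 (by rw [hWlen]; exact hpos b)
  have hread : ∀ b z, κ z = κ (t b) → ∀ j : ℕ, j < h b → ψ z j = ψ (t b) j :=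
    fun b z hz j hj => hψ.letter_at ((htow b z hz).1 j hj)
  -- The label is carried along because the code alone need not determine it.
  let σ := {x : Z × Bool // κ x.1 = κ (t x.2)}
  have hstepR : ∀ x : σ, ∃ y : σ, y.1.1 = τ (h x.1.2) x.1.1 := by
    rintro ⟨⟨z, b⟩, hz⟩
    obtain ⟨b', hb'⟩ := hcov _ (htow b z hz).2.1
    exact ⟨⟨(_, b'), hb'⟩, rfl⟩
  choose stepR hstepR using hstepR
  have hright : ∀ x : σ, ∃ s : ℕ → Bool, s 0 = x.1.2 ∧
      IsStream W s (fun j => ψ x.1.1 j) := by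
    intro x
    refine ⟨_, rfl, isStream_of_step stepR (fun x => x.1.2) (fun x j => ψ x.1.1 j) ?_ ?_ x⟩
    · intro x j hj
      refine Eq.trans ?_ (hread _ _ x.2 j (by simpa [hWlen] using hj)).symm
      simp [W]
    · intro x j
      rw [hstepR, hψ.equivariant, hWlen, add_comm]
      push_cast
      rfl
  have hstepL : ∀ x : σ, ∃ y : σ, y.1.1 = τ (-h y.1.2) x.1.1 := by
    rintro ⟨⟨z, b⟩, hz⟩
    obtain ⟨b', hb'⟩ := hback z (hz ▸ ht b)
    exact ⟨⟨(_, b'), hb'⟩, rfl⟩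
  -- Leftward reading starts at the top floor above the base point, so the current tower contributes
  -- its reversed word first.
  choose stepL hstepL using hstepL
  have hleft : ∀ x : σ, ∃ s : ℕ → Bool, s 0 = x.1.2 ∧
      IsStream (fun b => (W b).reverse) s (fun j => ψ x.1.1 (h x.1.2 - 1 - j)) := by
    intro x
    refine ⟨_, rfl, isStream_of_step stepL (fun x => x.1.2)
      (fun x j => ψ x.1.1 (h x.1.2 - 1 - j)) ?_ ?_ x⟩
    · intro x j hj
      have hj' : j < h x.1.2 := by simpa [hWlen] using hj
      have e : (h x.1.2 : ℤ) - 1 - j = ((h x.1.2 - 1 - j : ℕ) : ℤ) := by omega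
      refine Eq.trans ?_ ((congrArg _ e).trans (hread _ _ x.2 _ (by omega))).symm
      simp [W]
    · intro x j
      rw [hstepL, hψ.equivariant, List.length_reverse, hWlen]
      congr 1
      push_cast
      ring
  -- If the words commuted, the streams from `t true` and from one tower height later would
  -- coincide, giving the period `h true` to the right.
  have hne : W true ++ W false ≠ W false ++ W true := by
    intro hc
    let x : σ := ⟨(t true, true), rfl⟩
    obtain ⟨s, -, hs⟩ := hright x
    obtain ⟨s', -, hs'⟩ := hright (stepR x)
    have heq := stream_eq_of_comm hW hc hs hs'
    obtain ⟨M, hM⟩ := hψ.aperiodic (h true) (hpos true)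
    obtain ⟨i, -, hi⟩ := hM (t true)
    apply hi
    have := congrFun heq i
    simp only [hstepR, hψ.equivariant] at this
    rw [add_comm]
    exact this.symm
  have hneR : (W true).reverse ++ (W false).reverse ≠ (W false).reverse ++ (W true).reverse := by
    rw [← List.reverse_append, ← List.reverse_append]
    exact fun e => hne (List.reverse_injective e).symm
  obtain ⟨d, u, c, hc, hd⟩ := exists_stream_prefix hW hne
  obtain ⟨d', u', c', hc', hd'⟩ := exists_stream_prefix (W := fun b => (W b).reverse)
    (fun b => by simpa using hW b) hneR
  refine ⟨t, h, hpos, hcov, hback, ?_, ⟨d, u, c, hc, ?_⟩, ⟨d', u', c', hc', ?_⟩⟩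
  · intro b z hz
    have hp := hpos b
    have := (htow b z hz).1 (h b - 1) (by omega)
    simpa [hp] using this
  · intro z b hz
    obtain ⟨s, hs0, hs⟩ := hright ⟨(z, b), hz⟩
    have := hd _ _ hs
    rwa [hs0] at this
  · intro z b hz
    obtain ⟨s, hs0, hs⟩ := hleft ⟨(z, b), hz⟩
    have := hd' _ _ hs
    rwa [hs0] at this

/-- The long runs on which the letters are constant are obtained from the runs on which the tower
coding is constant by extending them by fixed amounts to the left and to the right. -/
theorem exists_run_extension [Finite Q] [Nonempty Z] (hκ : TowerCoding τ κ F)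
    (hψ : SymbolicPresentation τ κ ψ) :
    ∃ d' d R : ℕ, ∀ W : Set Z,
      (∀ e g, IsRun (constSet (fun i y => κ (τ i y)) W) e g →
        IsRun (constSet (fun i y => ψ y i) W) (e - d') (g + d)) ∧
      (∀ a b, IsRun (constSet (fun i y => ψ y i) W) a b → (R : ℤ) < b - a →
        ∃ e g, IsRun (constSet (fun i y => κ (τ i y)) W) e g ∧ a = e - d' ∧ b = g + d) := by
  obtain ⟨t, h, hpos, hcov, hback, htop, ⟨d, u, c, hc, hd⟩, ⟨d', u', c', hc', hd'⟩⟩ :=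
    hκ.exists_divergence hψ
  obtain ⟨ρ, hρ⟩ := hψ.recognizable
  have hinj : ∀ {c : Bool → A}, c true ≠ c false → ∀ b b', b ≠ b' → c b ≠ c b' := by
    intro c hc b b' hb
    rcases b with _ | _ <;> rcases b' with _ | _
    exacts [absurd rfl hb, hc.symm, hc, absurd rfl hb]
  have h1 : ∀ W : Set Z, ∀ e g, IsRun (constSet (fun i y => κ (τ i y)) W) e g →
      IsRun (constSet (fun i y => ψ y i) W) (e - d') (g + d) := by
    intro W e g ⟨heg, hC, he, hg⟩
    -- The codes agree at `g - 1`. If one point of `W` were outside `F` at `g`, `next` would make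
    -- all codes agree at `g`. The left end is symmetric, with `prev`.
    have hgF : ∀ y ∈ W, κ (τ g y) ∈ F := by
      intro y hy
      by_contra hyF
      have hstep : ∀ y, τ g y = τ 1 (τ (g - 1) y) := fun y => by rw [← hκ.add, sub_add_cancel]
      have : ∀ y' ∈ W, κ (τ g y) = κ (τ g y') := by
        intro y' hy'
        rw [hstep, hstep]
        refine hκ.next _ _ (hC (g - 1) (by omega) (by omega) y hy y' hy') ?_
        rwa [← hstep]
      exact hg fun y₁ h₁ y₂ h₂ => (this y₁ h₁).symm.trans (this y₂ h₂)
    have heF : ∀ y ∈ W, κ (τ e y) ∈ F := by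
      intro y hy
      by_contra hyF
      have hstep : ∀ y, τ (e - 1) y = τ (-1) (τ e y) := fun y => by
        rw [← hκ.add, sub_eq_add_neg]
      have : ∀ y' ∈ W, κ (τ (e - 1) y) = κ (τ (e - 1) y') := by
        intro y' hy'
        rw [hstep, hstep]
        exact hκ.prev _ _ (hC e le_rfl heg y hy y' hy') hyF
      exact he fun y₁ h₁ y₂ h₂ => (this y₁ h₁).symm.trans (this y₂ h₂)
    have hR : ∀ y ∈ W, ∃ b, κ (τ g y) = κ (t b) ∧ (∀ j : ℕ, j < d → ψ y (g + j) = u j) ∧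
        ψ y (g + d) = c b := by
      intro y hy
      obtain ⟨b, hb⟩ := hcov _ (hgF y hy)
      have := hd _ _ hb
      simp only [hψ.equivariant] at this
      exact ⟨b, hb, this⟩
    have hL : ∀ y ∈ W, ∃ b, κ (τ (e - 1) y) = κ (τ (h b - 1) (t b)) ∧
        (∀ j : ℕ, j < d' → ψ y (e - 1 - j) = u' j) ∧ ψ y (e - 1 - d') = c' b := by
      intro y hy
      obtain ⟨b, hb⟩ := hback _ (heF y hy)
      have h3 := hd' _ _ hb
      have h4 := htop _ _ hb
      simp only [hψ.equivariant] at h3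
      rw [← hκ.add, ← hκ.add] at h4
      have e1 : e + (-(h b : ℤ) + (h b - 1)) = e - 1 := by ring
      have e2 : ∀ j : ℤ, e + (-(h b : ℤ) + (h b - 1 - j)) = e - 1 - j := fun j => by ring
      simp only [e2] at h3
      rw [e1] at h4
      exact ⟨b, h4, h3⟩
    refine ⟨by omega, ?_, ?_, ?_⟩
    · intro i hi1 hi2 y hy y' hy'
      rcases lt_or_ge i e with h | h
      · obtain ⟨_, -, h3, -⟩ := hL y hy
        obtain ⟨_, -, h4, -⟩ := hL y' hy'
        have e1 : i = e - 1 - ((e - 1 - i).toNat : ℤ) := by omega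
        change ψ y i = ψ y' i
        rw [e1, h3 _ (by omega), h4 _ (by omega)]
      rcases lt_or_ge i g with h' | h'
      · exact hψ.letter_at (hC i h h' y hy y' hy')
      · obtain ⟨_, -, h3, -⟩ := hR y hy
        obtain ⟨_, -, h4, -⟩ := hR y' hy'
        have e1 : i = g + ((i - g).toNat : ℤ) := by omega
        change ψ y i = ψ y' i
        rw [e1, h3 _ (by omega), h4 _ (by omega)]
    · obtain ⟨y, hy, y', hy', hne⟩ := exists_ne_of_notMem_constSet he
      obtain ⟨b, hb, -, hb'⟩ := hL y hy
      obtain ⟨b₁, hb₁, -, hb₁'⟩ := hL y' hy'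
      intro hmem
      have := hmem y hy y' hy'
      have e1 : e - d' - 1 = e - 1 - d' := by ring
      simp only [e1, hb', hb₁'] at this
      refine hinj hc' b b₁ ?_ this
      rintro rfl
      exact hne (hb.trans hb₁.symm)
    · obtain ⟨y, hy, y', hy', hne⟩ := exists_ne_of_notMem_constSet hg
      obtain ⟨b, hb, -, hb'⟩ := hR y hy
      obtain ⟨b₁, hb₁, -, hb₁'⟩ := hR y' hy'
      intro hmem
      have := hmem y hy y' hy'
      simp only [hb', hb₁'] at this
      refine hinj hc b b₁ ?_ this
      rintro rfl
      exact hne (hb.trans hb₁.symm)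
  -- A letter run longer than `2 * ρ` contains a full recognition window around `a + ρ`. The code is
  -- constant there, and the extension of its run meets the given run, hence equals it.
  refine ⟨d', d, 2 * ρ, fun W => ⟨h1 W, ?_⟩⟩
  intro a b hrun hlen
  push_cast at hlen
  have hCD : constSet (fun i y => κ (τ i y)) W ⊆ constSet (fun i y => ψ y i) W :=
    fun i hi y hy y' hy' => hψ.letter_at (hi y hy y' hy')
  have hmid : a + ρ ∈ constSet (fun i y => κ (τ i y)) W := by
    intro y hy y' hy'
    refine hρ _ _ fun i hi1 hi2 => ?_
    rw [hψ.equivariant, hψ.equivariant]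
    exact hrun.2.1 _ (by omega) (by omega) y hy y' hy'
  obtain ⟨e, g, heg, he, hg⟩ := exists_isRun hmid (fun h => hrun.2.2.1 (hCD h)) (by omega)
    (fun h => hrun.2.2.2 (hCD h)) (by omega)
  exact ⟨e, g, heg, hrun.unique (h1 W e g heg) (i := a + ρ) (by omega) (by omega) (by omega)
    (by omega)⟩

end TowerCoding

/-! ### Finite levels of a Bratteli–Vershik system -/

namespace OrderedBratteliDiagram

variable {B : OrderedBratteliDiagram}

lemma r_eq_of_le {n : ℕ} {e f : B.E n} (h : e ≤ f) : B.r e = B.r f :=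
  (B.comparable_iff n e f).1 (Or.inl h)

lemma covBy_unique_right {n : ℕ} {e f f' : B.E n} (h : e ⋖ f) (h' : e ⋖ f') : f = f' := by
  rcases (B.comparable_iff n f f').2 ((r_eq_of_le h.le).symm.trans (r_eq_of_le h'.le)) with hf | hf
  · exact (hf.eq_or_lt).resolve_right fun hlt => h'.2 h.lt hlt
  · exact ((hf.eq_or_lt).resolve_right fun hlt => h.2 h'.lt hlt).symm

lemma covBy_unique_left {n : ℕ} {e e' f : B.E n} (h : e ⋖ f) (h' : e' ⋖ f) : e = e' := by
  rcases (B.comparable_iff n e e').2 ((r_eq_of_le h.le).trans (r_eq_of_le h'.le).symm) with he | he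
  · exact (he.eq_or_lt).resolve_right fun hlt => h.2 hlt h'.lt
  · exact ((he.eq_or_lt).resolve_right fun hlt => h'.2 hlt h.lt).symm

lemma isMin_unique {n : ℕ} {e f : B.E n} (he : IsMin e) (hf : IsMin f) (h : B.r e = B.r f) :
    e = f := by
  rcases (B.comparable_iff n e f).2 h with h | h
  · exact le_antisymm h (hf h)
  · exact le_antisymm (he h) h

lemma isMax_unique {n : ℕ} {e f : B.E n} (he : IsMax e) (hf : IsMax f) (h : B.r e = B.r f) :
    e = f := by
  rcases (B.comparable_iff n e f).2 h with h | h
  · exact le_antisymm h (he h)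
  · exact le_antisymm (hf h) h

/-- If edges with the property `P` are determined by their ranges, then an initial path of such
edges is determined by its end. -/
lemma eq_of_source_eq {P : ∀ n, B.E n → Prop}
    (hP : ∀ n (e f : B.E n), P n e → P n f → B.r e = B.r f → e = f) (x y : B.PathSpace) :
    ∀ m, B.s (x.val m) = B.s (y.val m) → (∀ i < m, P i (x.val i)) → (∀ i < m, P i (y.val i)) →
      ∀ i < m, x.val i = y.val i := by
  intro m
  induction m with
  | zero => intro _ _ _ i hi; omega
  | succ m ih =>
    intro hs hx hy
    have hm : x.val m = y.val m :=
      hP m _ _ (hx m (by omega)) (hy m (by omega)) (by rw [x.2, y.2, hs])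
    intro i hi
    rcases Nat.lt_succ_iff_lt_or_eq.1 hi with h | rfl
    · exact ih (by rw [hm]) (fun i hi => hx i (by omega)) (fun i hi => hy i (by omega)) i h
    · exact hm

variable {L : B.PathSpace → B.PathSpace}

lemma IsVershikMap.isMin_of_isMax (hL : B.IsVershikMap L) {x : B.PathSpace} {n : ℕ}
    (h : ∀ i < n, IsMax (x.val i)) : ∀ i < n, IsMin ((L x).val i) := by
  classical
  by_cases hall : ∀ n, IsMax (x.val n)
  · exact fun i _ => hL.1 x hall i
  · push Not at hall
    intro i hi
    have hk : n ≤ Nat.find hall := by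
      by_contra hlt
      exact Nat.find_spec hall (h _ (by omega))
    exact (hL.2 x (Nat.find hall) (fun i hi => not_not.1 (Nat.find_min hall hi))
      (Nat.find_spec hall)).2.1 i (by omega)

lemma IsVershikMap.exists_step (hL : B.IsVershikMap L) {x : B.PathSpace} {n : ℕ}
    (h : ¬ ∀ i < n, IsMin ((L x).val i)) :
    ∃ k < n, (∀ i < k, IsMax (x.val i)) ∧ ¬ IsMax (x.val k) ∧ x.val k ⋖ (L x).val k ∧
      (∀ i < k, IsMin ((L x).val i)) ∧ ∀ i, k < i → (L x).val i = x.val i := by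
  classical
  have hex : ∃ k, k < n ∧ ¬ IsMax (x.val k) := by
    by_contra! hno
    exact h (hL.isMin_of_isMax hno)
  obtain ⟨h1, h2⟩ := Nat.find_spec hex
  have h3 : ∀ i < Nat.find hex, IsMax (x.val i) := by
    intro i hi
    by_contra hmax
    exact Nat.find_min hex hi ⟨by omega, hmax⟩
  exact ⟨_, h1, h3, h2, hL.2 x _ h3 h2⟩

/-- Unless the first `n` edges of the image are all minimal, the carry stops before level `n`. The
edge to be raised is then visible in the first `n` edges, and the minimal path below its successor
is determined by its end vertex. -/
lemma IsVershikMap.eq_next (hL : B.IsVershikMap L) {x y : B.PathSpace} {n : ℕ}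
    (hxy : ∀ i < n, x.val i = y.val i) (h : ¬ ∀ i < n, IsMin ((L x).val i)) :
    ∀ i < n, (L x).val i = (L y).val i := by
  obtain ⟨k, hk, hmax, hnmax, hcov, hmin, hlater⟩ := hL.exists_step h
  obtain ⟨hcov', hmin', hlater'⟩ := hL.2 y k (fun i hi => hxy i (by omega) ▸ hmax i hi)
    (hxy k hk ▸ hnmax)
  have heq : (L x).val k = (L y).val k := by
    rw [← hxy k hk] at hcov'
    exact covBy_unique_right hcov hcov'
  intro i hi
  rcases lt_trichotomy i k with h | rfl | h
  · exact eq_of_source_eq (P := fun _ e => IsMin e) (fun n e f => isMin_unique) _ _ k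
      (by rw [heq]) hmin hmin' i h
  · exact heq
  · rw [hlater i h, hlater' i h, hxy i hi]

/-- The level of the raised edge can be read off the image as that of its first non-minimal edge;
below it the preimage is the maximal path to a known vertex. -/
lemma IsVershikMap.eq_prev (hL : B.IsVershikMap L) {x y : B.PathSpace} {n : ℕ}
    (hxy : ∀ i < n, (L x).val i = (L y).val i) (h : ¬ ∀ i < n, IsMin ((L x).val i)) :
    ∀ i < n, x.val i = y.val i := by
  have h' : ¬ ∀ i < n, IsMin ((L y).val i) := fun hy => h fun i hi => hxy i hi ▸ hy i hi
  obtain ⟨k, hk, hmax, -, hcov, hmin, hlater⟩ := hL.exists_step h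
  obtain ⟨k', hk', hmax', -, hcov', hmin', hlater'⟩ := hL.exists_step h'
  obtain rfl : k = k' := by
    rcases lt_trichotomy k k' with hlt | heq | hlt
    · have := hmin' k hlt
      rw [← hxy k hk] at this
      exact absurd hcov.lt this.not_lt
    · exact heq
    · have := hmin k' hlt
      rw [hxy k' hk'] at this
      exact absurd hcov'.lt this.not_lt
  have heq : x.val k = y.val k := by
    rw [← hxy k hk] at hcov'
    exact covBy_unique_left hcov hcov'
  intro i hi
  rcases lt_trichotomy i k with h | rfl | h
  · exact eq_of_source_eq (P := fun _ e => IsMax e) (fun n e f => isMax_unique) _ _ k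
      (by rw [heq]) hmax hmax' i h
  · exact heq
  · rw [← hlater i h, ← hlater' i h, hxy i hi]

end OrderedBratteliDiagram

/-! ### Local determination on compact spaces -/

lemma three_le_card {α : Type*} [Finite α] {a b c : α} (hab : a ≠ b) (hac : a ≠ c)
    (hbc : b ≠ c) : 3 ≤ Nat.card α := by
  classical
  have _ := Fintype.ofFinite α
  rw [Nat.card_eq_fintype_card, ← Finset.card_eq_three.2 ⟨a, b, c, hab, hac, hbc, rfl⟩]
  exact Finset.card_le_univ _

/-- A locally constant function on a compact space of families depends on finitely many
coordinates only. -/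
lemma exists_finset_of_isLocallyConstant {K ι B : Type*} {E : ι → Type*} [TopologicalSpace K]
    [CompactSpace K] [∀ i, TopologicalSpace (E i)] [∀ i, DiscreteTopology (E i)]
    {v : K → ∀ i, E i} (hv : Topology.IsInducing v) {φ : K → B} (hφ : IsLocallyConstant φ) :
    ∃ s : Finset ι, ∀ x y, (∀ i ∈ s, v x i = v y i) → φ x = φ y := by
  classical
  have hloc : ∀ x, ∃ s : Finset ι, ∀ y, (∀ i ∈ s, v y i = v x i) → φ y = φ x := by
    intro x
    have hx : {y | φ y = φ x} ∈ nhds x := (IsLocallyConstant.iff_eventually_eq φ).1 hφ x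
    rw [hv.nhds_eq_comap, Filter.mem_comap] at hx
    obtain ⟨U, hU, hUφ⟩ := hx
    rw [nhds_pi, Filter.mem_pi'] at hU
    obtain ⟨s, t, ht, hst⟩ := hU
    refine ⟨s, fun y hy => hUφ (hst fun i hi => ?_)⟩
    rw [hy i hi]
    exact mem_of_mem_nhds (ht i)
  choose s hs using hloc
  have hopen : ∀ x, {y | ∀ i ∈ s x, v y i = v x i} ∈ nhds x := by
    intro x
    refine (Filter.eventually_all_finset (s x)).2 fun i _ => ?_
    have hc : Continuous fun y => v y i := (continuous_apply i).comp hv.continuous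
    exact hc.continuousAt.eventually (p := fun a => a = v x i) (by simp)
  obtain ⟨t, ht⟩ := CompactSpace.elim_nhds_subcover _ hopen
  refine ⟨t.biUnion s, fun x y hxy => ?_⟩
  have hx : x ∈ ⋃ x ∈ t, {y | ∀ i ∈ s x, v y i = v x i} := by
    change x ∈ ⋃ x ∈ t, (fun x => {y | ∀ i ∈ s x, v y i = v x i}) x
    rw [ht]
    trivial
  obtain ⟨z, hz, hxz⟩ := Set.mem_iUnion₂.1 hx
  rw [hs z x hxz, hs z y fun i hi => ?_]
  rw [← hxy i (Finset.mem_biUnion.2 ⟨z, hz, hi⟩)]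
  exact hxz i hi

/-! ### Tower codings of subshifts of rank two -/

section Subshifts

variable {A : Type*} [TopologicalSpace A]

/-- The `ℤ`-action on a subshift. -/
def act (X : Subshift A ℤ) (k : ℤ) (z : X.carrier) : X.carrier :=
  ⟨shift k z.1, X.mapsTo k z.2⟩

lemma act_add (X : Subshift A ℤ) (a b : ℤ) (z : X.carrier) :
    act X (a + b) z = act X b (act X a z) :=
  Subtype.ext (SymbolicDynamics.FullShift.shift_add a b z.1)

lemma act_zero (X : Subshift A ℤ) (z : X.carrier) : act X 0 z = z :=
  Subtype.ext (SymbolicDynamics.FullShift.shift_zero z.1)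

lemma map_act {X Y : Subshift A ℤ} {f : X.carrier → Y.carrier}
    (hf : ∀ x, f (shiftOn X x) = shiftOn Y (f x)) (k : ℤ) (z : X.carrier) :
    f (act X k z) = act Y k (f z) := by
  have hf1 : ∀ x, f (act X 1 x) = act Y 1 (f x) := hf
  induction k with
  | zero => rw [act_zero, act_zero]
  | succ k ih => rw [act_add, hf1, ih, ← act_add]
  | pred k ih =>
    have h1 := hf1 (act X (-k - 1) z)
    rw [← act_add, sub_add_cancel, ih] at h1
    have h2 := congrArg (act Y (-1)) h1
    rw [← act_add, ← act_add, add_neg_cancel, act_zero] at h2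
    exact h2.symm

/-- Compactness: points with period `t` on longer and longer intervals, recentred, would accumulate
at a point of `X` with period `t`. -/
lemma exists_bound_of_isAperiodic [Finite A] [DiscreteTopology A] {X : Subshift A ℤ}
    (hX : IsAperiodic X) (t : ℕ) (ht : 0 < t) :
    ∃ M : ℕ, ∀ x ∈ X.carrier, ∃ i : ℕ, i < M ∧ x (i + t) ≠ x i := by
  by_contra! hno
  let C : ℕ → Set (ℤ → A) := fun M =>
    X.carrier ∩ ⋂ i ∈ Set.Ico (-M : ℤ) M, {x | x (i + t) = x i}
  have hclosed : ∀ M, IsClosed (C M) := fun M =>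
    X.isClosed.inter <| isClosed_biInter fun i _ =>
      isClosed_eq (continuous_apply _) (continuous_apply _)
  obtain ⟨x, hx⟩ := IsCompact.nonempty_iInter_of_sequence_nonempty_isCompact_isClosed C
    (fun M => Set.inter_subset_inter_right _ <| Set.biInter_subset_biInter_left <|
      Set.Ico_subset_Ico (by push_cast; omega) (by push_cast; omega))
    (fun M => by
      obtain ⟨x, hxX, hx⟩ := hno (2 * M)
      refine ⟨shift M x, X.mapsTo _ hxX, ?_⟩
      simp only [Set.mem_iInter, Set.mem_Ico, Set.mem_ofPred_eq,
        SymbolicDynamics.FullShift.shift_apply]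
      intro i hi
      have := hx (M + i).toNat (by omega)
      rw [Int.toNat_of_nonneg (by omega), add_assoc] at this
      exact this)
    (hclosed 0).isCompact hclosed
  rw [Set.mem_iInter] at hx
  refine hX x (hx 0).1 ⟨t, ht, fun i => ?_⟩
  have := (hx (i.natAbs + 1)).2
  simp only [Set.mem_iInter, Set.mem_Ico, Set.mem_ofPred_eq] at this
  exact this i (by omega)

lemma exists_window [Finite A] [DiscreteTopology A] {X : Subshift A ℤ} {B : Type*}
    {φ : X.carrier → B} (hφ : IsLocallyConstant φ) :
    ∃ ρ : ℕ, ∀ z z' : X.carrier, (∀ i : ℤ, -ρ ≤ i → i ≤ ρ → z.1 i = z'.1 i) → φ z = φ z' := by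
  have : CompactSpace X.carrier := isCompact_iff_compactSpace.1 X.isClosed.isCompact
  obtain ⟨s, hs⟩ := exists_finset_of_isLocallyConstant
    (Topology.IsInducing.subtypeVal (t := X.carrier)) hφ
  refine ⟨s.sup Int.natAbs, fun z z' h => hs z z' fun i hi => ?_⟩
  have := Finset.le_sup (f := Int.natAbs) hi
  exact h i (by omega) (by omega)

/-- A Bratteli–Vershik representation of rank two provides tower codings for which two conjugate
subshifts are symbolic presentations. -/
theorem exists_towerCoding [Finite A] [DiscreteTopology A] {X Y : Subshift A ℤ}
    (hXne : X.carrier.Nonempty) (hXa : IsAperiodic X) (hYa : IsAperiodic Y)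
    (hXr : HasTopologicalRank (shiftOn X) 2)
    (f : X.carrier ≃ₜ Y.carrier) (hf : ∀ x, f (shiftOn X x) = shiftOn Y (f x)) :
    ∃ (Q : Type) (κ : X.carrier → Q) (F : Set Q), Finite Q ∧ TowerCoding (act X) κ F ∧
      SymbolicPresentation (act X) κ (fun z => z.1) ∧
      SymbolicPresentation (act X) κ (fun z => (f z).1) := by
  obtain ⟨B, ⟨-, -, L, hL, e, he⟩, hrank⟩ := hXr.1
  have hcX : CompactSpace X.carrier := isCompact_iff_compactSpace.1 X.isClosed.isCompact
  have hcB : CompactSpace B.PathSpace := e.compactSpace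
  let _ : ∀ n, TopologicalSpace (B.E n) := fun _ => ⊥
  have _ : ∀ n, DiscreteTopology (B.E n) := fun _ => ⟨rfl⟩
  have hind : Topology.IsInducing fun x : B.PathSpace => x.val := ⟨rfl⟩
  have hlet : IsLocallyConstant fun x : B.PathSpace => ((e.symm x).1 0, (f (e.symm x)).1 0) := by
    rw [IsLocallyConstant.iff_continuous]
    have h1 : Continuous fun z : X.carrier => z.1 0 :=
      (continuous_apply (0 : ℤ)).comp continuous_subtype_val
    have h2 : Continuous fun z : Y.carrier => z.1 0 :=
      (continuous_apply (0 : ℤ)).comp continuous_subtype_val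
    exact (h1.comp e.symm.continuous).prodMk (h2.comp (f.continuous.comp e.symm.continuous))
  obtain ⟨s, hs⟩ := exists_finset_of_isLocallyConstant hind hlet
  -- The lower limit `2` gives at most two vertices on infinitely many levels; one is taken past
  -- every edge on which the two letters depend.
  obtain ⟨n, hn, hcard⟩ : ∃ n, s.sup id + 1 ≤ n ∧ Nat.card (B.V n) ≤ 2 := by
    have h3 : B.rank < 3 := by rw [hrank]; norm_num
    have := Filter.frequently_lt_of_liminf_lt (by isBoundedDefault) h3
    obtain ⟨n, hn, h⟩ := (Filter.frequently_atTop.1 this) (s.sup id + 1)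
    refine ⟨n, hn, ?_⟩
    have : Nat.card (B.V n) < 3 := by exact_mod_cast h
    omega
  have hfV := B.finite_V n
  have hfE := B.finite_E
  let κ : X.carrier → ∀ i : Fin n, B.E i := fun z i => (e z).val i
  let F : Set (∀ i : Fin n, B.E i) := {q | ∀ i, IsMin (q i)}
  have hκ : ∀ {z z'}, κ z = κ z' ↔ ∀ i < n, (e z).val i = (e z').val i := fun {z z'} =>
    ⟨fun h i hi => congrFun h ⟨i, hi⟩, fun h => funext fun i => h i i.2⟩
  have hF : ∀ {z}, κ z ∈ F ↔ ∀ i < n, IsMin ((e z).val i) := fun {z} =>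
    ⟨fun h i hi => h ⟨i, hi⟩, fun h i => h i i.2⟩
  have heL : ∀ z, e (act X 1 z) = L (e z) := he
  have hletter : ∀ z z', κ z = κ z' → z.1 0 = z'.1 0 ∧ (f z).1 0 = (f z').1 0 := by
    intro z z' h
    have := hs (e z) (e z') fun i hi => hκ.1 h i (by
      have := Finset.le_sup (f := id) hi
      simp only [id] at this
      omega)
    simpa using this
  have hκc : IsLocallyConstant κ := by
    rw [IsLocallyConstant.iff_continuous]
    refine continuous_pi fun i => ?_
    exact (continuous_apply _).comp (hind.continuous.comp e.continuous)
  refine ⟨∀ i : Fin n, B.E i, κ, F, inferInstance, ⟨act_zero X, act_add X, ?_, ?_, ?_⟩,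
    ⟨fun _ _ _ => rfl, fun z z' h => (hletter z z' h).1, exists_window hκc, fun t ht => ?_⟩,
    ⟨fun k z i => by rw [map_act hf]; rfl, fun z z' h => (hletter z z' h).2, ?_, fun t ht => ?_⟩⟩
  · intro z z' h hz
    rw [hF, heL] at hz
    rw [hκ, heL, heL]
    exact hL.eq_next (hκ.1 h) hz
  · intro z z' h hz
    have hback : ∀ z, e z = L (e (act X (-1) z)) := fun z => by
      rw [← heL, ← act_add, neg_add_cancel, act_zero]
    rw [hF, hback] at hz
    rw [hκ, hback, hback z'] at h
    rw [hκ]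
    exact hL.eq_prev h hz
  · obtain ⟨z₀, hz₀⟩ := hXne
    by_contra! hno
    obtain ⟨z₁, hF₁, -, -⟩ := hno (κ ⟨z₀, hz₀⟩) (κ ⟨z₀, hz₀⟩)
    obtain ⟨z₂, hF₂, h21, -⟩ := hno (κ z₁) (κ z₁)
    obtain ⟨z₃, hF₃, h31, h32⟩ := hno (κ z₁) (κ z₂)
    -- A minimal initial path is determined by its end vertex at level `n`, so three codes in `F`
    -- would need three vertices there.
    have hsrc : ∀ z z', κ z ∈ F → κ z' ∈ F → κ z ≠ κ z' →
        B.s ((e z).val n) ≠ B.s ((e z').val n) := fun z z' h h' hne hs =>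
      hne <| hκ.2 <| OrderedBratteliDiagram.eq_of_source_eq (P := fun _ e => IsMin e)
        (fun n e f => OrderedBratteliDiagram.isMin_unique) _ _ n hs (hF.1 h) (hF.1 h')
    have h1 := hsrc _ _ hF₂ hF₁ h21
    have h2 := hsrc _ _ hF₃ hF₁ h31
    have h3 := hsrc _ _ hF₃ hF₂ h32
    have := three_le_card h1.symm h2.symm h3.symm
    omega
  · obtain ⟨M, hM⟩ := exists_bound_of_isAperiodic hXa t ht
    exact ⟨M, fun z => hM z.1 z.2⟩
  · have : IsLocallyConstant fun y => κ (f.symm y) := hκc.comp_continuous f.symm.continuous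
    obtain ⟨ρ, hρ⟩ := exists_window this
    exact ⟨ρ, fun z z' h => by simpa using hρ (f z) (f z') h⟩
  · obtain ⟨M, hM⟩ := exists_bound_of_isAperiodic hYa t ht
    exact ⟨M, fun z => hM (f z).1 (f z).2⟩

end Subshifts

/-! ### Closures of orbits under powers of the shift -/

section Orbits

variable {A : Type*}

lemma per_mono {p q : ℕ} (h : p ∣ q) (x : ℤ → A) : per p x ⊆ per q x := by
  obtain ⟨c, rfl⟩ := h
  intro i hi k
  have := hi (k * c)
  rw [← this]
  congr 1
  push_cast
  ring

lemma IsToeplitzSeq.exists_common {x : ℤ → A} (hx : IsToeplitzSeq x) (s : Finset ℤ) :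
    ∃ q : ℕ, 0 < q ∧ ∀ j ∈ s, j ∈ per q x := by
  classical
  induction s using Finset.induction_on with
  | empty => exact ⟨1, one_pos, by simp⟩
  | insert a s _ ih =>
    obtain ⟨q, hq, hs⟩ := ih
    obtain ⟨r, hr, ha⟩ := hx a
    refine ⟨r * q, by positivity, fun j hj => ?_⟩
    rcases Finset.mem_insert.1 hj with rfl | h
    · exact per_mono (dvd_mul_right _ _) x ha
    · exact per_mono (dvd_mul_left _ _) x (hs j h)

/-- The positions at which all elements of `W` agree. -/
abbrev fixedSet (W : Set (ℤ → A)) : Set ℤ := constSet (fun i y => y i) W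

lemma mem_fixedSet_image_shift {W : Set (ℤ → A)} {k i : ℤ} :
    i ∈ fixedSet (shift k '' W) ↔ k + i ∈ fixedSet W := by
  simp [constSet]

lemma isRun_fixedSet_image_shift {W : Set (ℤ → A)} {k a b : ℤ} :
    IsRun (fixedSet (shift k '' W)) a b ↔ IsRun (fixedSet W) (k + a) (k + b) := by
  simp only [IsRun, mem_fixedSet_image_shift]
  refine and_congr (by omega) (and_congr ⟨fun h i h1 h2 => ?_, fun h i h1 h2 => ?_⟩
    (by rw [add_sub_assoc]))
  · have := h (i - k) (by omega) (by omega)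
    rwa [add_sub_cancel] at this
  · exact h (k + i) (by omega) (by omega)

variable [TopologicalSpace A]

/-- The shift by `k` as a homeomorphism. -/
def shiftHomeo (k : ℤ) : (ℤ → A) ≃ₜ (ℤ → A) where
  toFun := shift k
  invFun := shift (-k)
  left_inv x := by funext i; simp
  right_inv x := by funext i; simp
  continuous_toFun := SymbolicDynamics.FullShift.continuous_shift k
  continuous_invFun := SymbolicDynamics.FullShift.continuous_shift (-k)

lemma mem_closure_iff_window [DiscreteTopology A] {s : Set (ℤ → A)} {y : ℤ → A} :
    y ∈ closure s ↔ ∀ M : ℕ, ∃ x ∈ s, ∀ i : ℤ, -M ≤ i → i ≤ M → x i = y i := by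
  constructor
  · intro h M
    obtain ⟨x, hx, hxs⟩ := mem_closure_iff.1 h _
      (SymbolicDynamics.FullShift.isOpen_cylinder (Finset.Icc (-M : ℤ) M) y) (fun _ _ => rfl)
    exact ⟨x, hxs, fun i h1 h2 => hx i (Finset.mem_Icc.2 ⟨h1, h2⟩)⟩
  · intro h
    rw [mem_closure_iff_nhds]
    intro t ht
    rw [nhds_pi, Filter.mem_pi'] at ht
    obtain ⟨I, u, hu, hst⟩ := ht
    obtain ⟨x, hxs, hx⟩ := h (I.sup Int.natAbs)
    refine ⟨x, hst fun i hi => ?_, hxs⟩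
    have := Finset.le_sup (f := Int.natAbs) (Finset.mem_coe.1 hi)
    rw [hx i (by omega) (by omega)]
    exact mem_of_mem_nhds (hu i)

/-- The closure of the orbit of `w` under `S ^ p`. -/
def orbClosure (p : ℕ) (w : ℤ → A) : Set (ℤ → A) :=
  closure (Set.range fun m : ℤ => shift (m * p) w)

lemma self_mem_orbClosure (p : ℕ) (w : ℤ → A) : w ∈ orbClosure p w :=
  subset_closure ⟨0, by simp⟩

lemma mem_orbClosure_iff [DiscreteTopology A] {p : ℕ} {y w : ℤ → A} :
    y ∈ orbClosure p w ↔
      ∀ M : ℕ, ∃ m : ℤ, ∀ i : ℤ, -M ≤ i → i ≤ M → w (m * p + i) = y i := by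
  simp [orbClosure, mem_closure_iff_window]

lemma image_shift_orbClosure (p : ℕ) (k : ℤ) (w : ℤ → A) :
    shift k '' orbClosure p w = orbClosure p (shift k w) := by
  change (shiftHomeo k) '' _ = _
  rw [orbClosure, (shiftHomeo k).image_closure, ← Set.range_comp]
  congr 2
  funext m i
  simp only [shiftHomeo, Homeomorph.homeomorph_mk_coe, Function.comp, Equiv.coe_fn_mk,
    SymbolicDynamics.FullShift.shift_apply]
  congr 1
  ring

lemma orbClosure_shift_mul (p : ℕ) (m : ℤ) (w : ℤ → A) :
    orbClosure p (shift (m * p) w) = orbClosure p w := by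
  refine congrArg closure (Set.ext fun y => ⟨?_, ?_⟩)
  · rintro ⟨k, rfl⟩
    refine ⟨m + k, ?_⟩
    funext i
    simp only [SymbolicDynamics.FullShift.shift_apply]
    congr 1
    ring
  · rintro ⟨k, rfl⟩
    refine ⟨k - m, ?_⟩
    funext i
    simp only [SymbolicDynamics.FullShift.shift_apply]
    congr 1
    ring

lemma shift_mul_mem_orbClosure {p : ℕ} {w y : ℤ → A} (h : y ∈ orbClosure p w) (m : ℤ) :
    shift (m * p) y ∈ orbClosure p w := by
  rw [← orbClosure_shift_mul p m w, ← image_shift_orbClosure]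
  exact Set.mem_image_of_mem _ h

lemma closure_residueOrbit (x : ℤ → A) (p : ℕ) (k : ℤ) :
    closure (residueOrbit x p k) = orbClosure p (shift k x) := by
  refine congrArg closure (Set.ext fun y => ⟨?_, ?_⟩)
  · rintro ⟨i, hi, rfl⟩
    obtain ⟨c, hc⟩ := hi.symm.dvd
    refine ⟨c, ?_⟩
    funext j
    simp only [SymbolicDynamics.FullShift.shift_apply]
    congr 1
    linarith
  · rintro ⟨m, rfl⟩
    refine ⟨k + m * p, ?_, ?_⟩
    · simp [Int.ModEq]
    · funext j
      simp [add_assoc]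

lemma orbClosure_subset {X : Subshift A ℤ} {w : ℤ → A} (hw : w ∈ X.carrier) (p : ℕ) :
    orbClosure p w ⊆ X.carrier :=
  X.isClosed.closure_subset_iff.2 (by rintro _ ⟨m, rfl⟩; exact X.mapsTo _ hw)

variable {X : Subshift A ℤ} {x : ℤ → A} {p : ℕ}

lemma ToeplitzGenerates.exists_residue (hx : ToeplitzGenerates x X) (hp : 0 < p) {w : ℤ → A}
    (hw : w ∈ X.carrier) : ∃ k : ℤ, 0 ≤ k ∧ k < p ∧ w ∈ closure (residueOrbit x p k) := by
  have hU : (Set.range fun k : ℤ => shift k x) =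
      ⋃ k ∈ Set.Ico (0 : ℤ) p, residueOrbit x p k := by
    ext y
    simp only [Set.mem_range, Set.mem_iUnion, residueOrbit, Set.mem_Ico, exists_prop]
    constructor
    · rintro ⟨k, rfl⟩
      exact ⟨k % p, ⟨Int.emod_nonneg _ (by omega), Int.emod_lt_of_pos _ (by omega)⟩, k,
        (Int.mod_modEq k p).symm, rfl⟩
    · rintro ⟨k, -, i, -, rfl⟩
      exact ⟨i, rfl⟩
  rw [hx.2, hU, (Set.finite_Ico _ _).closure_biUnion] at hw
  simp only [Set.mem_iUnion, exists_prop] at hw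
  obtain ⟨k, hk, h⟩ := hw
  exact ⟨k, hk.1, hk.2, h⟩

lemma ToeplitzGenerates.mem (hx : ToeplitzGenerates x X) : x ∈ X.carrier := by
  rw [hx.2]
  exact subset_closure ⟨0, by simp⟩

variable [DiscreteTopology A]

/-- Each residue class is minimal under `S ^ p`: a window of `x` recurs with a period `q` that can
be taken to be a multiple of `p`, so it occurs, at a displacement divisible by `p` and less than
`q`, in every shift of `x` from the same class. -/
lemma ToeplitzGenerates.orbClosure_eq_of_mem_residue {x : ℤ → A} (hx : IsToeplitzSeq x) {p : ℕ}
    (hp : 0 < p) {k : ℤ} {w : ℤ → A} (hw : w ∈ closure (residueOrbit x p k)) :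
    orbClosure p w = closure (residueOrbit x p k) := by
  apply Set.Subset.antisymm
  · rw [closure_residueOrbit] at hw ⊢
    refine closure_minimal ?_ isClosed_closure
    rintro _ ⟨m, rfl⟩
    exact shift_mul_mem_orbClosure hw m
  · intro y hy
    rw [mem_orbClosure_iff]
    intro M
    rw [mem_closure_iff_window] at hy hw
    obtain ⟨_, ⟨i₀, hi₀, rfl⟩, hy⟩ := hy M
    obtain ⟨q₀, hq₀, hper⟩ := hx.exists_common (Finset.Icc (i₀ - M) (i₀ + M))
    obtain ⟨q, hq⟩ : ∃ q, q = q₀ * p := ⟨_, rfl⟩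
    have hqpos : (0 : ℤ) < q := by rw [hq]; positivity
    -- The extra `q` leaves room for the displacement `(i₀ - i₁) % q`.
    obtain ⟨_, ⟨i₁, hi₁, rfl⟩, hw⟩ := hw (M + q)
    have hdvd : (p : ℤ) ∣ (i₀ - i₁) % q := by
      have h1 : (p : ℤ) ∣ i₀ - i₁ := (hi₁.trans hi₀.symm).dvd
      have h2 : (p : ℤ) ∣ q := by rw [hq]; push_cast; exact dvd_mul_left _ _
      rw [Int.emod_def]
      exact dvd_sub h1 (h2.mul_right _)
    obtain ⟨m, hm⟩ := hdvd
    have h0 := Int.emod_nonneg (i₀ - i₁) hqpos.ne'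
    have h1 := Int.emod_lt_of_pos (i₀ - i₁) hqpos
    have h2 := Int.emod_add_mul_ediv (i₀ - i₁) q
    refine ⟨m, fun i hi hi' => ?_⟩
    have h3 : m * p = (i₀ - i₁) % q := by rw [hm]; ring
    rw [← hw _ (by push_cast; omega) (by push_cast; omega), ← hy i hi hi']
    simp only [SymbolicDynamics.FullShift.shift_apply]
    have := per_mono (q := q) ⟨p, hq⟩ x (hper (i₀ + i) (Finset.mem_Icc.2 (by omega)))
      (-((i₀ - i₁) / q))
    rw [← this, h3]
    congr 1
    linarith

lemma ToeplitzGenerates.orbClosure_eq (hx : ToeplitzGenerates x X) (hp : 0 < p) {w w' : ℤ → A}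
    (hw : w ∈ X.carrier) (hw' : w' ∈ orbClosure p w) : orbClosure p w' = orbClosure p w := by
  obtain ⟨k, -, -, hk⟩ := hx.exists_residue hp hw
  have h1 := ToeplitzGenerates.orbClosure_eq_of_mem_residue hx.1 hp hk
  rw [h1] at hw' ⊢
  exact ToeplitzGenerates.orbClosure_eq_of_mem_residue hx.1 hp hw'

/-- This removes the generating Toeplitz sequence from the description of the partition, so images
of parts under conjugacies can be recognized as parts. -/
lemma ToeplitzGenerates.mem_parts_iff (hx : ToeplitzGenerates x X) (hp : 0 < p)
    {W : Set (ℤ → A)} : W ∈ parts X p ↔ ∃ w ∈ X.carrier, W = orbClosure p w := by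
  constructor
  · rintro ⟨x', hx', k, -, -, rfl⟩
    exact ⟨shift k x', X.mapsTo k hx'.mem, closure_residueOrbit _ _ _⟩
  · rintro ⟨w, hw, rfl⟩
    obtain ⟨k, h0, h1, hk⟩ := hx.exists_residue hp hw
    exact ⟨x, hx, k, h0, h1, ToeplitzGenerates.orbClosure_eq_of_mem_residue hx.1 hp hk⟩

lemma ToeplitzGenerates.exists_shift_mem (hx : ToeplitzGenerates x X) (hp : 0 < p)
    {w v : ℤ → A} (hw : w ∈ X.carrier) (hv : v ∈ X.carrier) :
    ∃ k : ℤ, shift (-k) v ∈ orbClosure p w := by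
  obtain ⟨a, -, -, ha⟩ := hx.exists_residue hp hw
  obtain ⟨b, -, -, hb⟩ := hx.exists_residue hp hv
  refine ⟨b - a, ?_⟩
  rw [ToeplitzGenerates.orbClosure_eq_of_mem_residue hx.1 hp ha, closure_residueOrbit]
  rw [closure_residueOrbit] at hb
  have : shift a x = shift (-(b - a)) (shift b x) := by
    funext i
    simp only [SymbolicDynamics.FullShift.shift_apply]
    congr 1
    ring
  rw [this, ← image_shift_orbClosure]
  exact Set.mem_image_of_mem _ hb

/-! ### Skeletons and their blocks -/

/-- By minimality every element of the class is a limit of `S ^ p`-shifts of `v`, so periodicity of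
`v` at `i` forces a common letter at `i`. Skeleton blocks thereby become runs of `fixedSet`. -/
lemma ToeplitzGenerates.mem_per_iff (hx : ToeplitzGenerates x X) (hp : 0 < p) {w v : ℤ → A}
    (hw : w ∈ X.carrier) (hv : v ∈ orbClosure p w) {i : ℤ} :
    i ∈ per p v ↔ i ∈ fixedSet (orbClosure p w) := by
  constructor
  · intro h
    have key : ∀ y ∈ orbClosure p w, y i = v i := by
      intro y hy
      rw [← hx.orbClosure_eq hp hw hv, mem_orbClosure_iff] at hy
      obtain ⟨m, hm⟩ := hy i.natAbs
      rw [← hm i (by omega) (by omega), add_comm]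
      exact h m
    exact fun y hy y' hy' => (key y hy).trans (key y' hy').symm
  · intro h k
    have := h _ (shift_mul_mem_orbClosure hv k) v hv
    simpa [add_comm] using this

lemma ToeplitzGenerates.partSkel_eq_none_iff (hx : ToeplitzGenerates x X) (hp : 0 < p)
    {W : Set (ℤ → A)} (hW : W ∈ parts X p) {i : ℤ} :
    partSkel W p i = none ↔ i ∉ fixedSet W := by
  obtain ⟨w, hw, rfl⟩ := (hx.mem_parts_iff hp).1 hW
  have hne : (orbClosure p w).Nonempty := ⟨w, self_mem_orbClosure p w⟩
  rw [partSkel, dif_pos hne, skel, ← hx.mem_per_iff hp hw hne.some_mem]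
  simp

lemma ToeplitzGenerates.add_mem_fixedSet_iff (hx : ToeplitzGenerates x X) (hp : 0 < p)
    {W : Set (ℤ → A)} (hW : W ∈ parts X p) {i : ℤ} (k : ℤ) :
    i + k * p ∈ fixedSet W ↔ i ∈ fixedSet W := by
  obtain ⟨w, hw, rfl⟩ := (hx.mem_parts_iff hp).1 hW
  constructor
  · intro h y hy y' hy'
    have := h _ (shift_mul_mem_orbClosure hy (-k)) _ (shift_mul_mem_orbClosure hy' (-k))
    simpa [add_comm] using this
  · intro h y hy y' hy'
    have := h _ (shift_mul_mem_orbClosure hy k) _ (shift_mul_mem_orbClosure hy' k)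
    simpa [add_comm] using this

lemma ToeplitzGenerates.image_shift_mem_parts (hx : ToeplitzGenerates x X) (hp : 0 < p)
    {W : Set (ℤ → A)} (hW : W ∈ parts X p) (k : ℤ) : shift k '' W ∈ parts X p := by
  obtain ⟨w, hw, rfl⟩ := (hx.mem_parts_iff hp).1 hW
  exact (hx.mem_parts_iff hp).2 ⟨shift k w, X.mapsTo k hw, image_shift_orbClosure p k w⟩

/-- The blank at `-1` reappears at `p - 1`, so the infimum defining the length is attained; the
bound by `p` makes the supremum in `maxLength` a genuine maximum. -/
lemma ToeplitzGenerates.isRun_blockLength (hx : ToeplitzGenerates x X) (hp : 0 < p)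
    {W : Set (ℤ → A)} (hW : W ∈ partsStar X p) :
    IsRun (fixedSet W) 0 (blockLength W p) ∧ blockLength W p ≤ p := by
  obtain ⟨hW, h1, h0⟩ := hW
  have hne : ((p - 1 : ℕ) : ℤ) ∉ fixedSet W := by
    rw [hx.partSkel_eq_none_iff hp hW, ← hx.add_mem_fixedSet_iff hp hW 1] at h1
    have e : ((p - 1 : ℕ) : ℤ) = -1 + 1 * p := by omega
    rwa [e]
  have hmem : p - 1 ∈ {i : ℕ | partSkel W p (i : ℤ) = none} :=
    (hx.partSkel_eq_none_iff hp hW).2 hne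
  have hle : blockLength W p ≤ p - 1 := Nat.sInf_le hmem
  have hL : partSkel W p (blockLength W p : ℤ) = none := Nat.sInf_mem ⟨_, hmem⟩
  have hlt : ∀ i : ℕ, i < blockLength W p → (i : ℤ) ∈ fixedSet W := by
    intro i hi
    by_contra hn
    exact Nat.notMem_of_lt_sInf hi ((hx.partSkel_eq_none_iff hp hW).2 hn)
  refine ⟨⟨?_, fun i h2 h3 => ?_, ?_, ?_⟩, by omega⟩
  · have : blockLength W p ≠ 0 := fun h => h0 (by simpa [h] using hL)
    omega
  · have := hlt i.toNat (by omega)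
    rwa [Int.toNat_of_nonneg h2] at this
  · exact (hx.partSkel_eq_none_iff hp hW).1 (by simpa using h1)
  · exact (hx.partSkel_eq_none_iff hp hW).1 hL

lemma ToeplitzGenerates.mem_partsStar_of_isRun (hx : ToeplitzGenerates x X) (hp : 0 < p)
    {W : Set (ℤ → A)} (hW : W ∈ parts X p) {b : ℤ} (h : IsRun (fixedSet W) 0 b) :
    W ∈ partsStar X p ∧ (blockLength W p : ℤ) = b := by
  have hs : W ∈ partsStar X p := by
    refine ⟨hW, (hx.partSkel_eq_none_iff hp hW).2 (by simpa using h.2.2.1), ?_⟩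
    rw [Ne, hx.partSkel_eq_none_iff hp hW, not_not]
    exact h.2.1 0 le_rfl h.1
  have hr := (hx.isRun_blockLength hp hs).1
  exact ⟨hs, (hr.unique h (i := 0) le_rfl hr.1 le_rfl h.1).2⟩

lemma ToeplitzGenerates.blockLength_le_maxLength (hx : ToeplitzGenerates x X) (hp : 0 < p)
    {W : Set (ℤ → A)} (hW : W ∈ partsStar X p) : blockLength W p ≤ maxLength X p :=
  le_csSup ⟨p, by rintro _ ⟨V, hV, rfl⟩; exact (hx.isRun_blockLength hp hV).2⟩ ⟨W, hW, rfl⟩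

lemma ToeplitzGenerates.exists_mem_partsMax (hx : ToeplitzGenerates x X) (hp : 0 < p)
    (h : (partsStar X p).Nonempty) : (partsMax X p).Nonempty := by
  obtain ⟨W, hW, he⟩ := Nat.sSup_mem (h.image fun W => blockLength W p)
    ⟨p, by rintro _ ⟨V, hV, rfl⟩; exact (hx.isRun_blockLength hp hV).2⟩
  exact ⟨W, hW, he⟩

/-- If `x` is periodic along `[0, K]`, then some block is longer than `K`. -/
lemma ToeplitzGenerates.exists_long_block (hx : ToeplitzGenerates x X) (hX : IsAperiodic X)
    (hp : 0 < p) {K : ℕ} (hK : ∀ i : ℤ, 0 ≤ i → i ≤ K → i ∈ per p x) :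
    (partsStar X p).Nonempty ∧ K < maxLength X p := by
  have hW : orbClosure p x ∈ parts X p := (hx.mem_parts_iff hp).2 ⟨x, hx.mem, rfl⟩
  have hself := self_mem_orbClosure p x
  obtain ⟨c, hc⟩ : ∃ c, c ∉ fixedSet (orbClosure p x) := by
    by_contra! hall
    refine hX x hx.mem ⟨p, hp, fun i => ?_⟩
    have := (hx.mem_per_iff hp hx.mem hself).2 (hall i) 1
    simpa using this
  have hfix : ∀ i : ℤ, 0 ≤ i → i ≤ K → i ∈ fixedSet (orbClosure p x) := fun i h1 h2 =>
    (hx.mem_per_iff hp hx.mem hself).1 (hK i h1 h2)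
  have hcper := fun k => (hx.add_mem_fixedSet_iff hp hW (i := c) k).not.2 hc
  -- Translating the blank `c` by `± |c| * p` puts blanks on both sides of `0`.
  obtain ⟨e, g, hrun, he, hg⟩ := exists_isRun (hfix 0 le_rfl (by omega))
    (hcper (-(c.natAbs : ℤ))) (by nlinarith [abs_nonneg c, le_abs_self c, Int.abs_eq_natAbs c])
    (hcper (c.natAbs : ℤ)) (by nlinarith [abs_nonneg c, neg_abs_le c, Int.abs_eq_natAbs c])
  have hgK : K < g := by
    by_contra hle
    exact hrun.2.2.2 (hfix g (by omega) (by omega))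
  have hrun' : IsRun (fixedSet (shift e '' orbClosure p x)) 0 (g - e) := by
    rw [isRun_fixedSet_image_shift]
    simpa using hrun
  obtain ⟨hs, hl⟩ := hx.mem_partsStar_of_isRun hp (hx.image_shift_mem_parts hp hW e) hrun'
  have := hx.blockLength_le_maxLength hp hs
  exact ⟨⟨_, hs⟩, by omega⟩

end Orbits

/-! ### Block maps -/

section BlockMaps

variable {A : Type*} {p : ℕ}

lemma blockMap_apply (φ : Equiv.Perm (Fin p → A)) (x : ℤ → A) (k : ℤ) (j : Fin p) :
    blockMap p φ x (k * p + (j : ℕ)) = φ (fun j => x (k * p + (j : ℕ))) j := by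
  have hp : 0 < p := j.pos
  have hp' : (0 : ℤ) < p := by exact_mod_cast hp
  have hj : ((j : ℕ) : ℤ) < p := by exact_mod_cast j.2
  have hj0 : (0 : ℤ) ≤ (j : ℕ) := by positivity
  have h1 : (k * p + (j : ℕ)) / (p : ℤ) = k := by
    rw [add_comm, Int.add_mul_ediv_right _ _ hp'.ne', Int.ediv_eq_zero_of_lt hj0 hj, zero_add]
  have h2 : ((k * p + (j : ℕ)) % (p : ℤ)).toNat = j := by
    rw [add_comm, Int.add_mul_emod_self_right, Int.emod_eq_of_lt hj0 hj, Int.toNat_natCast]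
  simp only [blockMap, dif_pos hp, h1]
  exact congrArg _ (Fin.ext h2)

lemma eq_of_blocks (hp : 0 < p) {x y : ℤ → A}
    (h : ∀ (k : ℤ) (j : Fin p), x (k * p + (j : ℕ)) = y (k * p + (j : ℕ))) : x = y := by
  funext i
  have h0 := Int.emod_nonneg i (b := (p : ℤ)) (by omega)
  have h1 := Int.emod_lt_of_pos i (b := (p : ℤ)) (by omega)
  have := h (i / p) ⟨(i % p).toNat, by omega⟩
  simpa only [Int.toNat_of_nonneg h0, Int.ediv_mul_add_emod] using this

lemma blockMap_one (hp : 0 < p) (x : ℤ → A) : blockMap p 1 x = x :=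
  eq_of_blocks hp fun k j => by rw [blockMap_apply, Equiv.Perm.one_apply]

lemma blockMap_blockMap (hp : 0 < p) (φ ψ : Equiv.Perm (Fin p → A)) (x : ℤ → A) :
    blockMap p φ (blockMap p ψ x) = blockMap p (φ * ψ) x :=
  eq_of_blocks hp fun k j => by
    rw [blockMap_apply, blockMap_apply, Equiv.Perm.mul_apply]
    exact congrFun (congrArg φ (funext fun j => blockMap_apply ψ x k j)) j

lemma blockMap_inv_self (hp : 0 < p) (φ : Equiv.Perm (Fin p → A)) (x : ℤ → A) :
    blockMap p φ⁻¹ (blockMap p φ x) = x := by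
  rw [blockMap_blockMap hp, inv_mul_cancel, blockMap_one hp]

lemma blockMap_shift (hp : 0 < p) (φ : Equiv.Perm (Fin p → A)) (x : ℤ → A) (m : ℤ) :
    blockMap p φ (shift (m * p) x) = shift (m * p) (blockMap p φ x) :=
  eq_of_blocks hp fun k j => by
    have h : ∀ j : Fin p, m * p + (k * p + ((j : ℕ) : ℤ)) = (m + k) * p + (j : ℕ) :=
      fun j => by ring
    rw [blockMap_apply]
    simp only [SymbolicDynamics.FullShift.shift_apply, h]
    rw [blockMap_apply]

lemma continuous_blockMap [TopologicalSpace A] [DiscreteTopology A]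
    (φ : Equiv.Perm (Fin p → A)) : Continuous (blockMap p φ) := by
  refine continuous_pi fun i => ?_
  unfold blockMap
  split_ifs with hp
  · have hφ : Continuous φ := continuous_of_discreteTopology
    refine (continuous_apply _).comp (hφ.comp (continuous_pi fun j => continuous_apply _))
  · exact continuous_apply i

lemma BlockEquiv.symm (hp : 0 < p) {K L : Set (ℤ → A)} (h : BlockEquiv p K L) :
    BlockEquiv p L K := by
  obtain ⟨φ, rfl⟩ := h
  refine ⟨φ⁻¹, ?_⟩
  rw [Set.image_image]
  simp [blockMap_inv_self hp]

lemma BlockEquiv.trans (hp : 0 < p) {K L M : Set (ℤ → A)} (h : BlockEquiv p K L)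
    (h' : BlockEquiv p L M) : BlockEquiv p K M := by
  obtain ⟨φ, rfl⟩ := h
  obtain ⟨ψ, rfl⟩ := h'
  refine ⟨ψ * φ, ?_⟩
  rw [Set.image_image]
  simp [blockMap_blockMap hp]

lemma BlockEquiv.refl (hp : 0 < p) (K : Set (ℤ → A)) : BlockEquiv p K K :=
  ⟨1, by simp [blockMap_one hp]⟩

lemma BlockEquiv.class_eq (hp : 0 < p) {K L : Set (ℤ → A)} (h : BlockEquiv p K L) :
    {M | BlockEquiv p K M} = {M | BlockEquiv p L M} :=
  Set.ext fun _ => ⟨(h.symm hp).trans hp, h.trans hp⟩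

lemma blockEquivFin_of_forall (hp : 0 < p) {𝒦 ℒ : Set (Set (ℤ → A))}
    (h : ∀ K ∈ 𝒦, ∃ L ∈ ℒ, BlockEquiv p K L) (h' : ∀ L ∈ ℒ, ∃ K ∈ 𝒦, BlockEquiv p L K) :
    BlockEquivFin p 𝒦 ℒ := by
  apply Set.Subset.antisymm
  · rintro _ ⟨K, hK, rfl⟩
    obtain ⟨L, hL, hKL⟩ := h K hK
    exact ⟨L, hL, (hKL.class_eq hp).symm⟩
  · rintro _ ⟨L, hL, rfl⟩
    obtain ⟨K, hK, hLK⟩ := h' L hL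
    exact ⟨K, hK, (hLK.class_eq hp).symm⟩

lemma BlockEquivFin.exists_blockEquiv (hp : 0 < p) {𝒦 ℒ : Set (Set (ℤ → A))}
    (h : BlockEquivFin p 𝒦 ℒ) {K : Set (ℤ → A)} (hK : K ∈ 𝒦) : ∃ L ∈ ℒ, BlockEquiv p K L := by
  have hmem : {M | BlockEquiv p K M} ∈ (fun L => {M | BlockEquiv p L M}) '' ℒ := by
    rw [← show _ = _ from h]
    exact ⟨K, hK, rfl⟩
  obtain ⟨L, hL, he⟩ := hmem
  refine ⟨L, hL, ?_⟩
  have : L ∈ {M | BlockEquiv p L M} := BlockEquiv.refl hp L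
  rw [show {M | BlockEquiv p L M} = {M | BlockEquiv p K M} from he] at this
  exact this

/-- A shift-compatible bijection between words of length `p` extends to a block map. -/
lemma exists_blockMap [Finite A] (hp : 0 < p) {I : Type*} (a b : I → ℤ → A)
    (hshift : ∀ i (m : ℤ), ∃ i', a i' = shift (m * p) (a i) ∧ b i' = shift (m * p) (b i))
    (hword : ∀ i i', (∀ j : Fin p, a i (j : ℕ) = a i' (j : ℕ)) ↔
      ∀ j : Fin p, b i (j : ℕ) = b i' (j : ℕ)) :
    ∃ φ : Equiv.Perm (Fin p → A), ∀ i, blockMap p φ (a i) = b i := by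
  classical
  have _ := Fintype.ofFinite A
  let word : (ℤ → A) → Fin p → A := fun x j => x (j : ℕ)
  have hword' : ∀ i i', word (a i) = word (a i') ↔ word (b i) = word (b i') := by
    intro i i'
    rw [funext_iff, funext_iff]
    exact hword i i'
  let f : (Fin p → A) → Fin p → A := fun w =>
    if h : ∃ i, word (a i) = w then word (b h.choose) else w
  have hf : ∀ i, f (word (a i)) = word (b i) := by
    intro i
    have h : ∃ i', word (a i') = word (a i) := ⟨i, rfl⟩
    simp only [f, dif_pos h]
    exact (hword' _ _).1 h.choose_spec
  have hinj : Set.InjOn f (Set.range fun i => word (a i)) := by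
    rintro _ ⟨i, rfl⟩ _ ⟨i', rfl⟩ h
    simp only [hf] at h
    exact (hword' _ _).2 h
  -- Only the values on occurring words matter; injectivity there extends to a permutation because
  -- there are finitely many words.
  obtain ⟨g, hg⟩ := Set.MapsTo.exists_equiv_extend_of_card_eq
    (t := (Finset.univ : Finset (Fin p → A))) rfl (fun _ _ => by simp) hinj
  let φ : Equiv.Perm (Fin p → A) :=
    g.trans (Equiv.subtypeUnivEquiv (fun _ => Finset.mem_univ _))
  have hφ : ∀ i, φ (word (a i)) = word (b i) := fun i => (hg _ ⟨i, rfl⟩).trans (hf i)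
  refine ⟨φ, fun i => eq_of_blocks hp fun k j => ?_⟩
  rw [blockMap_apply]
  obtain ⟨i', ha, hb⟩ := hshift i k
  have h1 : (fun j : Fin p => a i (k * p + (j : ℕ))) = word (a i') := by rw [ha]; rfl
  have h2 : b i (k * p + (j : ℕ)) = word (b i') j := by rw [hb]; rfl
  rw [h1, h2, hφ]

end BlockMaps

/-! ### Conjugate subshifts have equivalent families -/

section Conjugacy

variable {A : Type*} [TopologicalSpace A] {X Y : Subshift A ℤ}
  {x y : ℤ → A} {p : ℕ}

/-- The image of a set under a map between subshifts. -/
def imageOn (f : X.carrier → Y.carrier) (W : Set (ℤ → A)) : Set (ℤ → A) :=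
  (fun z => (f z).1) '' (Subtype.val ⁻¹' W)

lemma imageOn_orbClosure (f : X.carrier ≃ₜ Y.carrier)
    (hf : ∀ x, f (shiftOn X x) = shiftOn Y (f x)) (z : X.carrier) :
    imageOn f (orbClosure p z.1) = orbClosure p (f z).1 := by
  have h1 : Subtype.val ⁻¹' orbClosure p z.1 =
      closure (Set.range fun m : ℤ => act X (m * p) z) := by
    ext v
    refine Iff.trans ?_ closure_subtype.symm
    rw [← Set.range_comp]
    rfl
  have h2 : imageOn f (orbClosure p z.1) =
      Subtype.val '' (f '' (Subtype.val ⁻¹' orbClosure p z.1)) := by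
    rw [Set.image_image]
    rfl
  rw [h2, h1, f.image_closure, ← Y.isClosed.isClosedEmbedding_subtypeVal.closure_image_eq,
    ← Set.range_comp, ← Set.range_comp, orbClosure]
  congr 2
  funext m
  simp only [Function.comp, map_act hf]
  rfl

lemma imageOn_shift {f : X.carrier → Y.carrier}
    (hf : ∀ x, f (shiftOn X x) = shiftOn Y (f x)) (k : ℤ) (W : Set (ℤ → A)) :
    imageOn f (shift k '' W) = shift k '' imageOn f W := by
  ext v
  constructor
  · rintro ⟨z, ⟨w, hw, hz⟩, rfl⟩
    have hz' : w = (act X (-k) z).1 := by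
      funext i
      simp [act, ← hz]
    refine ⟨_, ⟨act X (-k) z, by simpa [← hz'] using hw, rfl⟩, ?_⟩
    simp only [map_act hf]
    funext i
    simp [act]
  · rintro ⟨_, ⟨z, hz, rfl⟩, rfl⟩
    refine ⟨act X k z, ⟨z.1, hz, rfl⟩, ?_⟩
    simp only [map_act hf]
    rfl

variable [DiscreteTopology A]

lemma imageOn_mem_parts (hx : ToeplitzGenerates x X) (hy : ToeplitzGenerates y Y) (hp : 0 < p)
    (f : X.carrier ≃ₜ Y.carrier) (hf : ∀ x, f (shiftOn X x) = shiftOn Y (f x))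
    {W : Set (ℤ → A)} (hW : W ∈ parts X p) : imageOn f W ∈ parts Y p := by
  obtain ⟨w, hw, rfl⟩ := (hx.mem_parts_iff hp).1 hW
  exact (hy.mem_parts_iff hp).2 ⟨_, (f ⟨w, hw⟩).2, imageOn_orbClosure f hf ⟨w, hw⟩⟩

lemma ToeplitzGenerates.subset_of_mem_parts (hx : ToeplitzGenerates x X) (hp : 0 < p)
    {W : Set (ℤ → A)} (hW : W ∈ parts X p) : W ⊆ X.carrier := by
  obtain ⟨w, hw, rfl⟩ := (hx.mem_parts_iff hp).1 hW
  exact orbClosure_subset hw p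

lemma exists_radius [Finite A] {f : X.carrier → Y.carrier} (hfc : Continuous f)
    (hf : ∀ x, f (shiftOn X x) = shiftOn Y (f x)) :
    ∃ r : ℕ, ∀ (z z' : X.carrier) (k : ℤ),
      (∀ i, k - r ≤ i → i ≤ k + r → z.1 i = z'.1 i) → (f z).1 k = (f z').1 k := by
  have hloc : IsLocallyConstant fun z : X.carrier => (f z).1 0 := by
    rw [IsLocallyConstant.iff_continuous]
    exact (continuous_apply (0 : ℤ)).comp (continuous_subtype_val.comp hfc)
  obtain ⟨r, hr⟩ := exists_window hloc
  refine ⟨r, fun z z' k h => ?_⟩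
  have := hr (act X k z) (act X k z') fun i h1 h2 => h (k + i) (by omega) (by omega)
  simp only [map_act hf] at this
  simpa [act] using this

/-- If the skeleton of `V` is filled in a long interval around `0`, then a conjugacy followed by a
small shift acts on `V` as a block map. -/
lemma blockEquiv_image [Finite A] (hx : ToeplitzGenerates x X) (hp : 0 < p)
    (f : X.carrier ≃ₜ Y.carrier) (hf : ∀ x, f (shiftOn X x) = shiftOn Y (f x)) {r : ℕ}
    (hr : ∀ (z z' : X.carrier) (k : ℤ),
      (∀ i, k - r ≤ i → i ≤ k + r → z.1 i = z'.1 i) → (f z).1 k = (f z').1 k)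
    (hr' : ∀ (z z' : Y.carrier) (k : ℤ),
      (∀ i, k - r ≤ i → i ≤ k + r → z.1 i = z'.1 i) → (f.symm z).1 k = (f.symm z').1 k)
    {V : Set (ℤ → A)} (hV : V ∈ parts X p) {j ρ : ℤ} (hρ : r + |j| ≤ ρ)
    (hfix : ∀ i, -(2 * ρ) ≤ i → i ≤ 2 * ρ → i ∈ fixedSet V) :
    BlockEquiv p V (shift j '' imageOn f V) := by
  have hj := abs_le.1 (show |j| ≤ ρ - r by linarith)
  have hVX := hx.subset_of_mem_parts hp hV
  have hin : ∀ (z z' : X.carrier), z.1 ∈ V → z'.1 ∈ V → ∀ i, (-(2 * ρ) ≤ i → i < 0 → z.1 i = z'.1 i)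
      ∧ (p ≤ i → i ≤ p + 2 * ρ → z.1 i = z'.1 i) := by
    intro z z' hz hz' i
    refine ⟨fun h1 h2 => hfix i h1 (by omega) _ hz _ hz', fun h1 h2 => ?_⟩
    have h3 := hfix (i - p) (by omega) (by omega)
    rw [← hx.add_mem_fixedSet_iff hp hV 1] at h3
    have e : i - p + 1 * p = i := by ring
    rw [e] at h3
    exact h3 _ hz _ hz'
  have hout : ∀ (z z' : X.carrier), z.1 ∈ V → z'.1 ∈ V → ∀ i, (-ρ ≤ i → i ≤ 0 →
      (f z).1 (j + i) = (f z').1 (j + i)) ∧ (p ≤ i → i ≤ p + ρ →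
      (f z).1 (j + i) = (f z').1 (j + i)) := by
    intro z z' hz hz' i
    refine ⟨fun h1 h2 => hr _ _ _ fun k h3 h4 => hfix k (by omega) (by omega) _ hz _ hz',
      fun h1 h2 => hr _ _ _ fun k h3 h4 => ?_⟩
    have h3 := hfix (k - p) (by omega) (by omega)
    rw [← hx.add_mem_fixedSet_iff hp hV 1] at h3
    have e : k - p + 1 * p = k := by ring
    rw [e] at h3
    exact h3 _ hz _ hz'
  have hshift : ∀ (z : {z : X.carrier // z.1 ∈ V}) (m : ℤ), ∃ z' : {z : X.carrier // z.1 ∈ V},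
      z'.1.1 = shift (m * p) z.1.1 ∧ shift j (f z'.1).1 = shift (m * p) (shift j (f z.1).1) := by
    rintro ⟨z, hz⟩ m
    obtain ⟨w, hw, rfl⟩ := (hx.mem_parts_iff hp).1 hV
    refine ⟨⟨act X (m * p) z, shift_mul_mem_orbClosure hz m⟩, rfl, ?_⟩
    simp only [map_act hf]
    funext i
    simp only [act, SymbolicDynamics.FullShift.shift_apply, add_left_comm]
  -- Outside `[0, p)` the letters nearby are common to all of `V`, so equal words determine the
  -- images on `[j, j + p)`. Conversely, the images near the ends of that interval are common too,
  -- up to distance `ρ ≥ r + |j|`, so equal image words determine the original ones.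
  have hword : ∀ z z' : {z : X.carrier // z.1 ∈ V},
      (∀ i : Fin p, z.1.1 (i : ℕ) = z'.1.1 (i : ℕ)) ↔
        ∀ i : Fin p, shift j (f z.1).1 (i : ℕ) = shift j (f z'.1).1 (i : ℕ) := by
    rintro ⟨z, hz⟩ ⟨z', hz'⟩
    constructor
    · intro h i
      refine hr _ _ _ fun k h1 h2 => ?_
      have hi := i.2
      rcases lt_or_ge k 0 with hk | hk
      · exact (hin z z' hz hz' k).1 (by omega) hk
      rcases lt_or_ge k p with hk' | hk'
      · have := h ⟨k.toNat, by omega⟩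
        simpa only [Int.toNat_of_nonneg hk] using this
      · exact (hin z z' hz hz' k).2 hk' (by omega)
    · intro h i
      have hi := i.2
      have := hr' (f z) (f z') (i : ℕ) fun k h1 h2 => ?_
      · simpa using this
      obtain ⟨l, rfl⟩ : ∃ l, k = j + l := ⟨k - j, by ring⟩
      rcases lt_or_ge l 0 with hk | hk
      · exact (hout z z' hz hz' l).1 (by omega) (by omega)
      rcases lt_or_ge l p with hk' | hk'
      · have := h ⟨l.toNat, by omega⟩
        simpa only [Int.toNat_of_nonneg hk, SymbolicDynamics.FullShift.shift_apply] using this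
      · exact (hout z z' hz hz' l).2 hk' (by omega)
  obtain ⟨φ, hφ⟩ := exists_blockMap hp (I := {z : X.carrier // z.1 ∈ V}) (fun z => z.1.1)
    (fun z => shift j (f z.1).1) hshift hword
  refine ⟨φ, ?_⟩
  ext v
  constructor
  · rintro ⟨_, ⟨z, hz, rfl⟩, rfl⟩
    exact ⟨z.1, hz, hφ ⟨z, hz⟩⟩
  · rintro ⟨w, hw, rfl⟩
    exact ⟨_, ⟨⟨w, hVX hw⟩, hw, rfl⟩, (hφ ⟨⟨w, hVX hw⟩, hw⟩).symm⟩

/-- A conjugacy between aperiodic Toeplitz subshifts, the first of rank two, matches the members of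
`χ(X, p)` with members of `χ(Y, p)` if the longest blocks are long enough. -/
theorem exists_chi_blockEquiv [Finite A] (hx : ToeplitzGenerates x X)
    (hy : ToeplitzGenerates y Y) (hXa : IsAperiodic X) (hYa : IsAperiodic Y)
    (hXr : HasTopologicalRank (shiftOn X) 2) (f : X.carrier ≃ₜ Y.carrier)
    (hf : ∀ x, f (shiftOn X x) = shiftOn Y (f x)) :
    ∃ K : ℕ, ∀ p : ℕ, 0 < p → K < maxLength X p →
      ∀ V ∈ chi X p, ∃ U ∈ chi Y p, BlockEquiv p V U := by
  have hf' : ∀ y, f.symm (shiftOn Y y) = shiftOn X (f.symm y) := fun y => by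
    rw [f.symm_apply_eq, hf, f.apply_symm_apply]
  obtain ⟨Q, κ, F, _, hκ, hψ, hψ'⟩ := exists_towerCoding ⟨x, hx.mem⟩ hXa hYa hXr f hf
  have _ : Nonempty X.carrier := ⟨⟨x, hx.mem⟩⟩
  obtain ⟨d', d, R, hR⟩ := hκ.exists_run_extension hψ
  obtain ⟨c', c, R', hR'⟩ := hκ.exists_run_extension hψ'
  obtain ⟨r₁, hr₁⟩ := exists_radius f.continuous hf
  obtain ⟨r₂, hr₂⟩ := exists_radius f.symm.continuous hf'
  have hXset : ∀ {W : Set (ℤ → A)}, W ⊆ X.carrier →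
      constSet (fun i (z : X.carrier) => z.1 i) (Subtype.val ⁻¹' W) = fixedSet W := by
    intro W hW
    ext i
    exact ⟨fun h u hu v hv => h ⟨u, hW hu⟩ hu ⟨v, hW hv⟩ hv, fun h u hu v hv => h _ hu _ hv⟩
  have hYset : ∀ {W : Set (ℤ → A)},
      constSet (fun i (z : X.carrier) => (f z).1 i) (Subtype.val ⁻¹' W) =
        fixedSet (imageOn f W) := by
    intro W
    ext i
    constructor
    · rintro h _ ⟨u, hu, rfl⟩ _ ⟨v, hv, rfl⟩
      exact h u hu v hv
    · exact fun h u hu v hv => h _ ⟨u, hu, rfl⟩ _ ⟨v, hv, rfl⟩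
  have himg : ∀ {U : Set (ℤ → A)}, U ⊆ Y.carrier → imageOn f (imageOn f.symm U) = U := by
    intro U hU
    ext v
    constructor
    · rintro ⟨z, ⟨u, hu, hz⟩, rfl⟩
      obtain rfl : f.symm u = z := Subtype.ext hz
      simpa using hu
    · intro hv
      exact ⟨f.symm ⟨v, hU hv⟩, ⟨⟨v, hU hv⟩, hv, rfl⟩, by simp⟩
  -- `ρ` bounds the coding radius plus the displacement of the centres, with `1` for rounding the
  -- half-lengths. The threshold below makes the half-length exceed `2 * ρ` and lets both run
  -- extensions apply to the longest blocks.
  obtain ⟨ρ, hρ⟩ : ∃ ρ : ℕ, ρ = max r₁ r₂ + (d + d' + c + c' + 1) := ⟨_, rfl⟩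
  refine ⟨4 * ρ + 4 + R + R' + d + d', fun p hp hK V hV => ?_⟩
  obtain ⟨W, ⟨hWs, hWl⟩, rfl⟩ := hV
  have hW := hWs.1
  have hrun := (hx.isRun_blockLength hp hWs).1
  rw [hWl] at hrun
  obtain ⟨l, hl⟩ : ∃ l, l = maxLength X p := ⟨_, rfl⟩
  rw [← hl] at hrun hK
  obtain ⟨e, g, hCrun, he, hg⟩ := (hR (Subtype.val ⁻¹' W)).2 0 l
    (by rw [hXset (hx.subset_of_mem_parts hp hW)]; exact hrun) (by omega)
  have hYrun := (hR' (Subtype.val ⁻¹' W)).1 e g hCrun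
  rw [hYset] at hYrun
  have hfW := imageOn_mem_parts hx hy hp f hf hW
  have hU₀ := hy.image_shift_mem_parts hp hfW (e - c')
  obtain ⟨hU₀s, hU₀l⟩ := hy.mem_partsStar_of_isRun hp hU₀ (b := g - e + c + c') (by
    rw [isRun_fixedSet_image_shift]
    convert hYrun using 1 <;> ring)
  -- A longer block in `Y` would come from a longer run of `κ`, which would extend to a block in `X`
  -- longer than `l`.
  have hmax : ∀ U ∈ partsStar Y p, (blockLength U p : ℤ) ≤ g - e + c + c' := by
    intro U hU
    by_contra! hlt
    have hUr := (hy.isRun_blockLength hp hU).1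
    have hUX := imageOn_mem_parts hy hx hp f.symm hf' hU.1
    obtain ⟨e₂, g₂, hCrun₂, he₂, hg₂⟩ := (hR' (Subtype.val ⁻¹' imageOn f.symm U)).2 0
      (blockLength U p) (by
        rw [hYset, himg (hy.subset_of_mem_parts hp hU.1)]
        exact hUr) (by omega)
    have hXrun := (hR _).1 e₂ g₂ hCrun₂
    rw [hXset (hx.subset_of_mem_parts hp hUX)] at hXrun
    obtain ⟨hs, hb⟩ := hx.mem_partsStar_of_isRun hp
      (hx.image_shift_mem_parts hp hUX (e₂ - d')) (b := g₂ - e₂ + d + d') (by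
        rw [isRun_fixedSet_image_shift]
        convert hXrun using 1 <;> ring)
    have := hx.blockLength_le_maxLength hp hs
    omega
  have hYmax : blockLength (shift (e - c') '' imageOn f W) p = maxLength Y p := by
    refine le_antisymm (hy.blockLength_le_maxLength hp hU₀s) ?_
    refine csSup_le ⟨_, _, hU₀s, rfl⟩ ?_
    rintro _ ⟨U, hU, rfl⟩
    have := hmax U hU
    dsimp only
    omega
  refine ⟨_, ⟨_, ⟨hU₀s, hYmax⟩, rfl⟩, ?_⟩
  have hV := hx.image_shift_mem_parts hp hW ((maxLength X p / 2 : ℕ) : ℤ)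
  have hj : shift (((maxLength Y p / 2 : ℕ) : ℤ)) '' (shift (e - c') '' imageOn f W) =
      shift ((maxLength Y p / 2 : ℕ) + (e - c') - (maxLength X p / 2 : ℕ)) ''
        imageOn f (shift ((maxLength X p / 2 : ℕ) : ℤ) '' W) := by
    rw [imageOn_shift hf, Set.image_image, Set.image_image]
    refine Set.image_congr fun v _ => ?_
    funext i
    simp only [SymbolicDynamics.FullShift.shift_apply]
    congr 1
    ring
  simp only [hj]
  refine blockEquiv_image hx hp f hf (r := max r₁ r₂) (ρ := ρ)
    (fun z z' k h => hr₁ z z' k fun i h1 h2 => h i ?_ ?_)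
    (fun z z' k h => hr₂ z z' k fun i h1 h2 => h i ?_ ?_) hV ?_ ?_
  · have := le_max_left r₁ r₂; omega
  · have := le_max_left r₁ r₂; omega
  · have := le_max_right r₁ r₂; omega
  · have := le_max_right r₁ r₂; omega
  · have : |((maxLength Y p / 2 : ℕ) : ℤ) + (e - c') - (maxLength X p / 2 : ℕ)| ≤
        d + d' + c + c' + 1 := by
      rw [abs_le]
      omega
    rw [hρ]
    push_cast at this ⊢
    linarith
  · intro i h1 h2
    rw [mem_fixedSet_image_shift]
    exact hrun.2.1 _ (by omega) (by omega)

end Conjugacy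

/-! ### Essential periods and the scale -/

section EssentialPeriods

variable {A : Type*}

/-- A least positive period divides every period. -/
lemma dvd_of_periodic {B : Type*} {s : ℤ → B} {q : ℕ} (hq : 0 < q)
    (hper : Function.Periodic s (q : ℤ))
    (hmin : ∀ t : ℕ, 0 < t → t < q → ¬ ∀ i : ℤ, s (i + t) = s i) {k : ℤ}
    (hk : Function.Periodic s k) : (q : ℤ) ∣ k := by
  have h0 := Int.emod_nonneg k (b := (q : ℤ)) (by omega)
  have h1 := Int.emod_lt_of_pos k (b := (q : ℤ)) (by omega)
  by_contra hn
  have hne : k % q ≠ 0 := fun h => hn (Int.dvd_of_emod_eq_zero h)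
  refine hmin (k % q).toNat (by omega) (by omega) fun i => ?_
  rw [Int.toNat_of_nonneg h0, ← hper.int_mul (k / q) (i + k % q), ← hk i, add_assoc,
    mul_comm, Int.cast_id, Int.emod_add_mul_ediv]

lemma add_mem_per_iff {q : ℕ} {x : ℤ → A} {i : ℤ} : i + q ∈ per q x ↔ i ∈ per q x := by
  constructor
  · intro h k
    have h1 := h (k - 1)
    have h2 := h (-1)
    rw [show i + q + (k - 1) * q = i + k * q by ring] at h1
    rw [show i + q + -1 * q = i by ring] at h2
    rw [h1, h2]
  · intro h k
    have h1 := h (k + 1)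
    have h2 := h 1
    rw [show i + (k + 1) * q = i + q + k * q by ring] at h1
    rw [one_mul] at h2
    rw [h1, h2]

lemma skel_periodic (x : ℤ → A) (q : ℕ) : Function.Periodic (skel x q) (q : ℤ) := by
  intro i
  by_cases h : i ∈ per q x
  · rw [skel, skel, if_pos (add_mem_per_iff.2 h), if_pos h]
    simpa using h 1
  · rw [skel, skel, if_neg (mt add_mem_per_iff.1 h), if_neg h]

lemma mem_per_of_periodic_skel {x : ℤ → A} {q q' : ℕ}
    (h : Function.Periodic (skel x q) (q' : ℤ)) : per q x ⊆ per q' x := by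
  intro i hi k
  have h1 := h.int_mul k i
  rw [skel, skel, if_pos hi] at h1
  split_ifs at h1
  exact Option.some_injective _ h1

/-- The least period of the `q`-skeleton divides `q` and yields the same skeleton, so it is
essential. -/
lemma exists_isEssentialPeriod {x : ℤ → A} {q : ℕ} (hq : 0 < q) {i : ℤ} (hi : i ∈ per q x) :
    ∃ q', IsEssentialPeriod x q' ∧ i ∈ per q' x := by
  classical
  have hex : ∃ t : ℕ, 0 < t ∧ Function.Periodic (skel x q) (t : ℤ) := ⟨q, hq, skel_periodic x q⟩
  obtain ⟨hpos, hper⟩ := Nat.find_spec hex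
  have hmin : ∀ t : ℕ, 0 < t → t < Nat.find hex → ¬ ∀ i : ℤ, skel x q (i + t) = skel x q i :=
    fun t h1 h2 h3 => Nat.find_min hex h2 ⟨h1, h3⟩
  generalize Nat.find hex = q' at *
  have hdvd : q' ∣ q := by
    exact_mod_cast dvd_of_periodic hpos hper hmin (skel_periodic x q)
  have hpp : per q' x = per q x :=
    Set.Subset.antisymm (per_mono hdvd x) (mem_per_of_periodic_skel hper)
  have hskel : skel x q' = skel x q := by
    funext i
    simp only [skel, hpp]
  refine ⟨q', ⟨hpos, ?_⟩, hpp ▸ hi⟩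
  rw [hskel]
  exact hmin

lemma exists_le_of_le_iSup {s : Set ℕ} (hs : s.Nonempty) {g : ℕ → ℕ} {a : ℕ}
    (h : (a : ℕ∞) ≤ ⨆ n ∈ s, ((g n : ℕ) : ℕ∞)) : ∃ n ∈ s, a ≤ g n := by
  rcases Nat.eq_zero_or_pos a with rfl | ha
  · exact ⟨hs.some, hs.some_mem, Nat.zero_le _⟩
  · have hlt : ((a - 1 : ℕ) : ℕ∞) < ⨆ n ∈ s, ((g n : ℕ) : ℕ∞) :=
      lt_of_lt_of_le (by exact_mod_cast Nat.sub_lt ha one_pos) h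
    simp only [lt_iSup_iff] at hlt
    obtain ⟨n, hn, hlt⟩ := hlt
    have : a - 1 < g n := by exact_mod_cast hlt
    exact ⟨n, hn, by omega⟩

lemma exists_factorization_le {s t : Set ℕ} (h : lcmOf s = lcmOf t) (ht : t.Nonempty) {m : ℕ}
    (hm : m ∈ s) (q : ℕ) (hq : q.Prime) : ∃ n ∈ t, m.factorization q ≤ n.factorization q := by
  have h1 : ((m.factorization q : ℕ) : ℕ∞) ≤ lcmOf s ⟨q, hq⟩ :=
    le_iSup₂_of_le (f := fun n (_ : n ∈ s) => ((n.factorization q : ℕ) : ℕ∞)) m hm le_rfl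
  rw [h] at h1
  exact exists_le_of_le_iSup ht h1

lemma dvd_of_le {p : ℕ → ℕ} (hdvd : ∀ n, p n ∣ p (n + 1)) {m n : ℕ} (h : m ≤ n) : p m ∣ p n := by
  induction n, h using Nat.le_induction with
  | base => exact dvd_rfl
  | succ n _ ih => exact ih.trans (hdvd n)

lemma isEssentialPeriod_one (x : ℤ → A) : IsEssentialPeriod x 1 :=
  ⟨one_pos, fun q h1 h2 => by omega⟩

lemma exists_dvd_of_isEssentialPeriod {x : ℤ → A} {p : ℕ → ℕ} (hpos : ∀ n, 0 < p n)
    (hdvd : ∀ n, p n ∣ p (n + 1))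
    (hs : lcmOf (Set.range p) = lcmOf {q | IsEssentialPeriod x q}) {q : ℕ}
    (hq : IsEssentialPeriod x q) : ∃ N, ∀ n ≥ N, q ∣ p n := by
  have hex : ∀ l : ℕ, ∃ n, q.factorization l ≤ (p n).factorization l := by
    intro l
    by_cases hl : l.Prime
    · obtain ⟨_, ⟨n, rfl⟩, h⟩ := exists_factorization_le hs.symm ⟨_, 0, rfl⟩
        (show q ∈ {q | IsEssentialPeriod x q} from hq) l hl
      exact ⟨n, h⟩
    · exact ⟨0, by simp [Nat.factorization_eq_zero_of_not_prime _ hl]⟩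
  choose m hm using hex
  -- Only finitely many primes matter, and divisibility along `p` preserves every exponent already
  -- reached.
  refine ⟨q.primeFactors.sup m, fun n hn => ?_⟩
  rw [← Nat.factorization_le_iff_dvd hq.1.ne' (hpos n).ne']
  intro l
  by_cases hl : l ∈ q.primeFactors
  · refine (hm l).trans ?_
    exact (Nat.factorization_le_iff_dvd (hpos _).ne' (hpos n).ne').2
      (dvd_of_le hdvd ((Finset.le_sup hl).trans hn)) l
  · rw [Finsupp.notMem_support_iff.1 (by simpa using hl)]
    exact Nat.zero_le _

/-- Along the scale, every finite window of a Toeplitz sequence becomes periodic. -/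
lemma exists_forall_mem_per {x : ℤ → A} (hx : IsToeplitzSeq x) {p : ℕ → ℕ} (hpos : ∀ n, 0 < p n)
    (hdvd : ∀ n, p n ∣ p (n + 1))
    (hs : lcmOf (Set.range p) = lcmOf {q | IsEssentialPeriod x q}) (K : ℕ) :
    ∃ N, ∀ n ≥ N, ∀ i : ℤ, 0 ≤ i → i ≤ K → i ∈ per (p n) x := by
  have hex : ∀ i : ℤ, ∃ N, ∀ n ≥ N, i ∈ per (p n) x := by
    intro i
    obtain ⟨q, hq, hi⟩ := hx i
    obtain ⟨q', hq', hi'⟩ := exists_isEssentialPeriod hq hi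
    obtain ⟨N, hN⟩ := exists_dvd_of_isEssentialPeriod hpos hdvd hs hq'
    exact ⟨N, fun n hn => per_mono (hN n hn) x hi'⟩
  choose N hN using hex
  refine ⟨(Finset.Icc (0 : ℤ) K).sup N, fun n hn i h1 h2 => hN i n ?_⟩
  exact (Finset.le_sup (Finset.mem_Icc.2 ⟨h1, h2⟩)).trans hn

/-! ### Disjointness of parts and gluing of block maps -/

variable [TopologicalSpace A]

lemma orbClosure_subset_iUnion (p q : ℕ) (hq : 0 < q) (x : ℤ → A) :
    orbClosure p x ⊆ ⋃ c ∈ Set.Ico (0 : ℤ) q, orbClosure q (shift (c * p) x) := by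
  refine closure_minimal ?_
    ((Set.finite_Ico _ _).isClosed_biUnion fun c _ => isClosed_closure)
  rintro _ ⟨m, rfl⟩
  simp only [Set.mem_iUnion, exists_prop]
  refine ⟨m % q, ⟨Int.emod_nonneg _ (by omega), Int.emod_lt_of_pos _ (by omega)⟩, ?_⟩
  have h := shift_mul_mem_orbClosure (self_mem_orbClosure q (shift (m % q * p) x)) (m / q * p)
  convert h using 1
  rw [← SymbolicDynamics.FullShift.shift_add]
  congr 1
  nth_rw 1 [← Int.emod_add_mul_ediv m q]
  ring

variable [DiscreteTopology A] {X Y : Subshift A ℤ} {x y : ℤ → A} {p : ℕ}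

/-- Points of one class share their `p`-skeleton, so `k` is a period of `skel x p`, whose least
period is `p`. -/
lemma ToeplitzGenerates.dvd_of_isEssentialPeriod (hx : ToeplitzGenerates x X)
    (hp : IsEssentialPeriod x p) {k : ℤ} (hk : shift k x ∈ orbClosure p x) : (p : ℤ) ∣ k := by
  refine dvd_of_periodic hp.1 (skel_periodic x p) hp.2 fun i => ?_
  have h1 := hx.mem_per_iff hp.1 hx.mem (self_mem_orbClosure p x) (i := i)
  have h2 := hx.mem_per_iff hp.1 hx.mem hk (i := i)
  have h3 : i + k ∈ per p x ↔ i ∈ per p (shift k x) := by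
    simp only [per, SymbolicDynamics.FullShift.shift_apply, Set.mem_ofPred_eq]
    rw [add_comm i k]
    simp only [add_assoc]
  rw [h2, ← h1] at h3
  by_cases h : i ∈ per p x
  · have := h1.1 h _ hk _ (self_mem_orbClosure p x)
    rw [skel, skel, if_pos (h3.2 h), if_pos h]
    simpa [add_comm] using this
  · rw [skel, skel, if_neg (mt h3.1 h), if_neg h]

/-- The members of `Parts(X, p)` are disjoint if `p` divides the scale. -/
lemma ToeplitzGenerates.dvd_of_shift_mem (hx : ToeplitzGenerates x X) (hp : 0 < p)
    (hscale : ∀ l : ℕ, l.Prime → ∃ q, IsEssentialPeriod x q ∧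
      p.factorization l ≤ q.factorization l)
    {w : ℤ → A} (hw : w ∈ X.carrier) {k : ℤ} (hk : shift k w ∈ orbClosure p w) :
    (p : ℤ) ∣ k := by
  have hkx : shift k x ∈ orbClosure p x := by
    obtain ⟨j, hj⟩ := hx.exists_shift_mem hp hw hx.mem
    have h1 : shift k '' orbClosure p w = orbClosure p w := by
      rw [image_shift_orbClosure, hx.orbClosure_eq hp hw hk]
    have h2 : shift k (shift (-j) x) ∈ orbClosure p w := by
      rw [← h1]
      exact Set.mem_image_of_mem _ hj
    rw [← hx.orbClosure_eq hp hw hj] at h2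
    have h3 := Set.mem_image_of_mem (shift j) h2
    rw [image_shift_orbClosure] at h3
    have e1 : shift j (shift k (shift (-j) x)) = shift k x := by
      rw [← SymbolicDynamics.FullShift.shift_add, ← SymbolicDynamics.FullShift.shift_add]
      congr 1
      ring
    have e2 : shift j (shift (-j) x) = x := by
      rw [← SymbolicDynamics.FullShift.shift_add, neg_add_cancel,
        SymbolicDynamics.FullShift.shift_zero]
    rwa [e1, e2] at h3
  -- `p` itself need not be an essential period, so each prime power `l ^ a` dividing `p` is tested
  -- with an essential period `q` divisible by it. Refining the class modulo `q` gives `q ∣ k - c *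
  -- p`, and `l ^ a` divides `c * p`.
  rw [Int.natCast_dvd, Nat.dvd_iff_prime_pow_dvd_dvd]
  intro l a hl hla
  obtain ⟨q, hq, hle⟩ := hscale l hl
  have hlq : l ^ a ∣ q := by
    rw [hl.pow_dvd_iff_le_factorization hp.ne'] at hla
    rw [hl.pow_dvd_iff_le_factorization hq.1.ne']
    exact hla.trans hle
  obtain ⟨c, -, hc⟩ := Set.mem_iUnion₂.1 (orbClosure_subset_iUnion p q hq.1 x hkx)
  have hc' : shift (k - c * p) x ∈ orbClosure q x := by
    have h3 := Set.mem_image_of_mem (shift (-(c * p))) hc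
    rw [image_shift_orbClosure, ← SymbolicDynamics.FullShift.shift_add,
      ← SymbolicDynamics.FullShift.shift_add, add_neg_cancel,
      SymbolicDynamics.FullShift.shift_zero] at h3
    exact h3
  have h4 := hx.dvd_of_isEssentialPeriod hq hc'
  have h5 : ((l ^ a : ℕ) : ℤ) ∣ k - c * p := (Int.natCast_dvd_natCast.2 hlq).trans h4
  have h6 : ((l ^ a : ℕ) : ℤ) ∣ c * p := (Int.natCast_dvd_natCast.2 hla).mul_left c
  rw [← Int.natCast_dvd]
  exact (dvd_sub_left h6).1 h5

/-- Finitely many closed classes cover `X`, and distinct ones are disjoint. -/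
lemma ToeplitzGenerates.isOpen_preimage_orbClosure (hx : ToeplitzGenerates x X) (hp : 0 < p)
    {w : ℤ → A} (hw : w ∈ X.carrier) :
    IsOpen {z : X.carrier | z.1 ∈ orbClosure p w} := by
  have hcompl : {z : X.carrier | z.1 ∈ orbClosure p w}ᶜ =
      ⋃ k ∈ {k ∈ Set.Ico (0 : ℤ) p | orbClosure p (shift k x) ≠ orbClosure p w},
        Subtype.val ⁻¹' orbClosure p (shift k x) := by
    ext z
    simp only [Set.mem_compl_iff, Set.mem_ofPred_eq, Set.mem_iUnion, Set.mem_preimage,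
      exists_prop]
    constructor
    · intro hz
      obtain ⟨k, h0, h1, hk⟩ := hx.exists_residue hp z.2
      rw [closure_residueOrbit] at hk
      exact ⟨k, ⟨⟨h0, h1⟩, fun h => hz (h ▸ hk)⟩, hk⟩
    · rintro ⟨k, ⟨-, hne⟩, hk⟩ hz
      exact hne ((hx.orbClosure_eq hp (X.mapsTo k hx.mem) hk).symm.trans
        (hx.orbClosure_eq hp hw hz))
  rw [← isClosed_compl_iff, hcompl]
  exact ((Set.finite_Ico _ _).subset (Set.sep_subset _ _)).isClosed_biUnion fun k _ =>
    isClosed_closure.preimage continuous_subtype_val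

/-- A block map defined on one member of the partition extends to the whole subshift. -/
lemma ToeplitzGenerates.exists_extension (hx : ToeplitzGenerates x X) (hp : 0 < p)
    (hscale : ∀ l : ℕ, l.Prime → ∃ q, IsEssentialPeriod x q ∧
      p.factorization l ≤ q.factorization l)
    {w : ℤ → A} (hw : w ∈ X.carrier) (φ : Equiv.Perm (Fin p → A))
    (hφ : ∀ v ∈ orbClosure p w, blockMap p φ v ∈ Y.carrier) :
    ∃ F : X.carrier → Y.carrier, Continuous F ∧
      ∀ (z : X.carrier) (k : ℤ), shift (-k) z.1 ∈ orbClosure p w →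
        (F z).1 = shift k (blockMap p φ (shift (-k) z.1)) := by
  have hex : ∀ z : X.carrier, ∃ k : ℤ, shift (-k) z.1 ∈ orbClosure p w := fun z =>
    hx.exists_shift_mem hp hw z.2
  choose κ hκ using hex
  let F : X.carrier → Y.carrier := fun z =>
    ⟨shift (κ z) (blockMap p φ (shift (-κ z) z.1)), Y.mapsTo _ (hφ _ (hκ z))⟩
  -- Two admissible shifts differ by a multiple of `p`, and `blockMap` commutes with such shifts, so
  -- the value does not depend on the choice.
  have hF : ∀ (z : X.carrier) (k : ℤ), shift (-k) z.1 ∈ orbClosure p w →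
      (F z).1 = shift k (blockMap p φ (shift (-k) z.1)) := by
    intro z k hk
    have hmem : shift (κ z - k) (shift (-κ z) z.1) ∈ orbClosure p (shift (-κ z) z.1) := by
      rw [hx.orbClosure_eq hp hw (hκ z), ← SymbolicDynamics.FullShift.shift_add]
      convert hk using 2
      ring
    obtain ⟨m, hm⟩ := hx.dvd_of_shift_mem hp hscale (X.mapsTo _ z.2) hmem
    have hk' : shift (-k) z.1 = shift (m * p) (shift (-κ z) z.1) := by
      rw [← SymbolicDynamics.FullShift.shift_add]
      congr 1
      linarith
    rw [hk', blockMap_shift hp, ← SymbolicDynamics.FullShift.shift_add]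
    have hkz : m * p + k = κ z := by linarith
    rw [hkz]
  refine ⟨F, ?_, hF⟩
  rw [continuous_iff_continuousAt]
  intro z
  have hopen : IsOpen {z' : X.carrier | shift (-κ z) z'.1 ∈ orbClosure p w} := by
    have hc : Continuous (act X (-κ z)) :=
      ((SymbolicDynamics.FullShift.continuous_shift (-κ z)).comp
        continuous_subtype_val).subtype_mk _
    exact (hx.isOpen_preimage_orbClosure hp hw).preimage hc
  rw [Topology.IsInducing.subtypeVal.continuousAt_iff]
  have hc : Continuous fun z' : X.carrier => shift (κ z) (blockMap p φ (shift (-κ z) z'.1)) :=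
    (SymbolicDynamics.FullShift.continuous_shift _).comp ((continuous_blockMap φ).comp
      ((SymbolicDynamics.FullShift.continuous_shift _).comp continuous_subtype_val))
  refine hc.continuousAt.congr ?_
  filter_upwards [hopen.mem_nhds (hκ z)] with z' hz'
  exact (hF z' (κ z) hz').symm

/-- Block equivalent members of the partitions yield a conjugacy. -/
theorem conjugate_of_blockEquiv (hx : ToeplitzGenerates x X) (hy : ToeplitzGenerates y Y)
    (hp : 0 < p)
    (hX : ∀ l : ℕ, l.Prime → ∃ q, IsEssentialPeriod x q ∧ p.factorization l ≤ q.factorization l)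
    (hY : ∀ l : ℕ, l.Prime → ∃ q, IsEssentialPeriod y q ∧ p.factorization l ≤ q.factorization l)
    {W L : Set (ℤ → A)} (hW : W ∈ parts X p) (hL : L ∈ parts Y p) (h : BlockEquiv p W L) :
    Conjugate (shiftOn X) (shiftOn Y) := by
  obtain ⟨φ, hφ⟩ := h
  obtain ⟨w, hw, rfl⟩ := (hx.mem_parts_iff hp).1 hW
  obtain ⟨v, hv, rfl⟩ := (hy.mem_parts_iff hp).1 hL
  have hφ1 : ∀ u ∈ orbClosure p w, blockMap p φ u ∈ orbClosure p v := fun u hu => by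
    rw [hφ]
    exact Set.mem_image_of_mem _ hu
  have hφ2 : ∀ u ∈ orbClosure p v, blockMap p φ⁻¹ u ∈ orbClosure p w := by
    intro u hu
    rw [hφ] at hu
    obtain ⟨u, hu, rfl⟩ := hu
    rwa [blockMap_inv_self hp]
  obtain ⟨F, hFc, hF⟩ := hx.exists_extension (Y := Y) hp hX hw φ
    fun u hu => orbClosure_subset hv p (hφ1 u hu)
  obtain ⟨G, hGc, hG⟩ := hy.exists_extension (Y := X) hp hY hv φ⁻¹
    fun u hu => orbClosure_subset hw p (hφ2 u hu)
  have hss : ∀ (k : ℤ) (u : ℤ → A), shift (-k) (shift k u) = u := fun k u => by funext i; simp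
  have hss' : ∀ (k : ℤ) (u : ℤ → A), shift k (shift (-k) u) = u := fun k u => by funext i; simp
  refine ⟨⟨⟨F, G, fun z => Subtype.ext ?_, fun z => Subtype.ext ?_⟩, hFc, hGc⟩, fun z =>
    Subtype.ext ?_⟩
  · obtain ⟨k, hk⟩ := hx.exists_shift_mem hp hw z.2
    have h1 := hF z k hk
    rw [hG (F z) k (by rw [h1, hss]; exact hφ1 _ hk), h1, hss, blockMap_inv_self hp, hss']
  · obtain ⟨k, hk⟩ := hy.exists_shift_mem hp hv z.2
    have h1 := hG z k hk
    have h2 := blockMap_inv_self hp φ⁻¹ (shift (-k) z.1)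
    rw [inv_inv] at h2
    rw [hF (G z) k (by rw [h1, hss]; exact hφ2 _ hk), h1, hss, h2, hss']
  · obtain ⟨k, hk⟩ := hx.exists_shift_mem hp hw z.2
    have h3 : shift (-(k + 1)) (shiftOn X z).1 = shift (-k) z.1 := by
      change shift (-(k + 1)) (shift 1 z.1) = _
      rw [← SymbolicDynamics.FullShift.shift_add]
      congr 1
      ring
    change (F (shiftOn X z)).1 = shift 1 (F z).1
    rw [hF _ (k + 1) (by rw [h3]; exact hk), h3, hF z k hk, SymbolicDynamics.FullShift.shift_add]

lemma ToeplitzGenerates.mem_parts_of_mem_chi (hx : ToeplitzGenerates x X) (hp : 0 < p)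
    {V : Set (ℤ → A)} (hV : V ∈ chi X p) : V ∈ parts X p := by
  obtain ⟨W, hW, rfl⟩ := hV
  exact hx.image_shift_mem_parts hp hW.1.1 _

end EssentialPeriods

end ToeplitzRank

/-! ### The main theorem -/

theorem mainTheorem3 {A : Type*} [Finite A] [TopologicalSpace A] [DiscreteTopology A]
    (X Y : Subshift A ℤ)
    (hX : IsToeplitz X) (hXa : IsAperiodic X) (hXr : HasTopologicalRank (shiftOn X) 2)
    (hY : IsToeplitz Y) (hYa : IsAperiodic Y) (hYr : HasTopologicalRank (shiftOn Y) 2)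
    (p : ℕ → ℕ) (hpos : ∀ n, 0 < p n) (hmono : Monotone p) (hdvd : ∀ n, p n ∣ p (n + 1))
    (hXs : IsScale X (lcmOf (Set.range p))) (hYs : IsScale Y (lcmOf (Set.range p))) :
    Conjugate (shiftOn X) (shiftOn Y) ↔
      ∃ N : ℕ, ∀ n ≥ N, BlockEquivFin (p n) (chi X (p n)) (chi Y (p n)) := by
  obtain ⟨x, hx, hsx⟩ := hXs
  obtain ⟨y, hy, hsy⟩ := hYs
  constructor
  · rintro ⟨f, hf⟩
    have hf' : ∀ y, f.symm (shiftOn Y y) = shiftOn X (f.symm y) := fun y => by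
      rw [f.symm_apply_eq, hf, f.apply_symm_apply]
    obtain ⟨K, hK⟩ := exists_chi_blockEquiv hx hy hXa hYa hXr f hf
    obtain ⟨K', hK'⟩ := exists_chi_blockEquiv hy hx hYa hXa hYr f.symm hf'
    obtain ⟨N, hN⟩ := exists_forall_mem_per hx.1 hpos hdvd hsx K
    obtain ⟨N', hN'⟩ := exists_forall_mem_per hy.1 hpos hdvd hsy K'
    refine ⟨max N N', fun n hn => blockEquivFin_of_forall (hpos n) ?_ ?_⟩
    · exact hK _ (hpos n)
        (hx.exists_long_block hXa (hpos n) (hN n ((le_max_left _ _).trans hn))).2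
    · exact hK' _ (hpos n)
        (hy.exists_long_block hYa (hpos n) (hN' n ((le_max_right _ _).trans hn))).2
  · rintro ⟨N, hN⟩
    -- Periodicity at the single position `0` suffices for a block to exist, hence for `χ` to be
    -- nonempty.
    obtain ⟨N', hN'⟩ := exists_forall_mem_per hx.1 hpos hdvd hsx 0
    obtain ⟨n, hnN, hnN'⟩ : ∃ n, N ≤ n ∧ N' ≤ n := ⟨max N N', le_max_left _ _, le_max_right _ _⟩
    have hp := hpos n
    obtain ⟨W, hW⟩ := hx.exists_mem_partsMax hp (hx.exists_long_block hXa hp (hN' n hnN')).1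
    obtain ⟨L, hL, hWL⟩ := (hN n hnN).exists_blockEquiv hp ⟨W, hW, rfl⟩
    exact conjugate_of_blockEquiv hx hy hp
      (fun l hl => exists_factorization_le hsx ⟨1, isEssentialPeriod_one x⟩ ⟨n, rfl⟩ l hl)
      (fun l hl => exists_factorization_le hsy ⟨1, isEssentialPeriod_one y⟩ ⟨n, rfl⟩ l hl)
      (hx.mem_parts_of_mem_chi hp ⟨W, hW, rfl⟩) (hy.mem_parts_of_mem_chi hp hL) hWL
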